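/- **Setting.** Let $d\ge 1$, $m\ge 1$, $\alpha\ge 0$, $0<\beta\le 1$ with $\alpha\beta\le d$, let $\gamma_1,\dots,\gamma_m>0$, and let $C_\alpha,C_\beta,C_{\gamma_1},\dots,C_{\gamma_m},\mu_-,\mu_+,c_\mu,r_\mu>0$ be constants. All distributions below are distributions of a pair $(X,Y)$ with values in $[0,1]^d\times\{0,1\}$. For such a distribution $G$ let $G_X$ be the marginal law of $X$, $\operatorname{supp}(G_X)$ its support, and $\eta_G(x)=G(Y=1\mid X=x)$ for $x\in\operatorname{supp}(G_X)$, $\eta_G(x)=\frac12$ otherwise, the regression function (conditional probabilities are determined up to $G_X$-null sets; the conditions below are required for a suitable version). Let $\lambda$ be Lebesgue measure and $\|\cdot\|$ the Euclidean norm, and let $B(x,r)$ be the Euclidean ball. The class $\Pi=\Pi(\alpha,\beta,\boldsymbol\gamma,\mu)$ consists of all tuples $(P_1,\dots,P_m,Q)$ such that 1. (relative signal exponents) for every $i$ and every $x\in\operatorname{supp}(P_{i,X})\cup\operatorname{supp}(Q_X)$: $(\eta_{P_i}(x)-\frac12)(\eta_Q(x)-\frac12)\ge 0$ and $|\eta_{P_i}(x)-\frac12|\ge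 C_{\gamma_i}|\eta_Q(x)-\frac12|^{\gamma_i}$; 2. (margin) $Q_X(0<|\eta_Q(X)-\frac12|<t)\le C_\alpha t^\alpha$ for all $t>0$; 3. (smoothness) $|\eta_Q(x)-\eta_Q(y)|\le C_\beta\|x-y\|^\beta$ for all $x,y\in\operatorname{supp}(Q_X)$ (equivalently, $\eta_Q$ agrees on $\operatorname{supp}(Q_X)$ with a function that satisfies this inequality on all of $\mathbb R^d$); 4. (common support and strong density) for every $i$, $P_{i,X}$ and $Q_X$ are absolutely continuous with $\operatorname{supp}(P_{i,X})=\operatorname{supp}(Q_X)=:\Omega$; $\lambda(\Omega\cap B(x,r))\ge c_\mu\lambda(B(x,r))$ for all $x\in\Omega$, $0<r\le r_\mu$; and the densities of $P_{i,X}$ and $Q_X$ lie strictly between $\mu_-$ and $\mu_+$ almost everywhere on $\Omega$. For a measurable $f:\mathbb R^d\to\{0,1\}$ let $R_Q(f)=Q(Y\ne f(X))$, let $f_Q^*=\mathbf 1\{\eta_Q>\frac12\}$, and let $\mathcal E_Q(f)=R_Q(f)-R_Q(f_Q^*)$ be the excess risk. One observes independent samples: $n_{P_i}$ i.i.d. observations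 from $P_i$ ($1\le i\le m$) and $n_Q$ i.i.d. observations from $Q$. An empirical classifier $\hat f$ is a map from the data and a point of $\mathbb R^d$ to $\{0,1\}$, jointly measurable; $\mathbb E$ is the expectation over the data. **Conditions on the constants.** Assume that for some $0<\ell\le 1$ the uniform distribution on the cube $[0,\ell]^d$ meets the strong density condition with room to spare: $\mu_-\ell^d<1<\mu_+\ell^d$ and $c_\mu\max(1,r_\mu/\ell)^d<2^{-d}$. In the boundary case $\alpha\beta=d$ assume moreover that $C_\alpha\ge C_0$, where $C_0$ is a certain constant that depends only on $d,\alpha,\beta,C_\beta,\mu_-,\mu_+,c_\mu,r_\mu,\ell$. **Theorem (lower bound, multiple sources).** There is a constant $c>0$, not depending on the sample sizes, such that for all sample sizes $n_{P_1},\dots,n_{P_m},n_Q\ge 0$ that are not all zero, $$\inf_{\hat f}\ \sup_{(P_1,\dots,P_m,Q)\in\Pi}\mathbb E\,\mathcal E_Q(\hat f)\ \ge\ c\Big(n_Q+\sum_{i=1}^m n_{P_i}^{\frac{2\beta+d}{2\gamma_i\beta+d}}\Big)^{-\frac{\beta(1+\alpha)}{2\beta+d}}.$$ -/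

import Mathlib

open MeasureTheory
open scoped ENNReal

noncomputable section

namespace PosteriorDrift

/-- The feature space `ℝ^d` with the Euclidean norm. -/
abbrev Feature (d : ℕ) : Type := EuclideanSpace ℝ (Fin d)

/-- A labelled observation `(X, Y)`; the label `1` is `true` and the label `0` is `false`. -/
abbrev Obs (d : ℕ) : Type := Feature d × Bool

/-- The distribution of a pair `(X, Y)`. -/
abbrev Law (d : ℕ) : Type := ProbabilityMeasure (Obs d)

/-- The marginal distribution of the features. -/
def marginal {d : ℕ} (Q : Law d) : Measure (Feature d) := (Q : Measure (Obs d)).fst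

/-- The support of the marginal distribution of the features (a closed set). -/
def supp {d : ℕ} (Q : Law d) : Set (Feature d) := (marginal Q).support

open Classical in
/-- The regression function `η_Q(x) = Q(Y = 1 | X = x)` on the support and `1/2` off the support,
for one fixed choice of the regular conditional distribution. -/
def regression {d : ℕ} (Q : Law d) (x : Feature d) : ℝ :=
  if x ∈ supp Q then ((Q : Measure (Obs d)).condKernel x).real {true} else 1 / 2

/-- `η` is a version of the regression function of `Q`: conditional probabilities are determined
only up to null sets of the marginal distribution. -/
def IsRegression {d : ℕ} (Q : Law d) (η : Feature d → ℝ) : Prop :=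
  Measurable η ∧ (∀ x, 0 ≤ η x ∧ η x ≤ 1) ∧ (∀ x, x ∉ supp Q → η x = 1 / 2) ∧
    η =ᵐ[marginal Q] regression Q

open Classical in
/-- The Bayes classifier `1{η_Q > 1/2}`. -/
def bayes {d : ℕ} (Q : Law d) (x : Feature d) : Bool := decide (1 / 2 < regression Q x)

/-- The misclassification error `R_Q(f) = Q(Y ≠ f(X))`. -/
def risk {d : ℕ} (Q : Law d) (f : Feature d → Bool) : ℝ :=
  (Q : Measure (Obs d)).real {z | z.2 ≠ f z.1}

/-- The excess risk `R_Q(f) - R_Q(f*_Q)`. -/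
def excessRisk {d : ℕ} (Q : Law d) (f : Feature d → Bool) : ℝ := risk Q f - risk Q (bayes Q)

/-- Relative signal exponent `γ` with constant `C`, for regression functions `ηP` and `ηQ`. -/
def RelativeSignal {d : ℕ} (P Q : Law d) (ηP ηQ : Feature d → ℝ) (γ C : ℝ) : Prop :=
  ∀ x ∈ supp P ∪ supp Q,
    0 ≤ (ηP x - 1 / 2) * (ηQ x - 1 / 2) ∧ C * |ηQ x - 1 / 2| ^ γ ≤ |ηP x - 1 / 2|

/-- The `(β, C)`-Hölder condition on a set. For `0 < β ≤ 1` it holds iff the restriction to the set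
extends to a function on `ℝ^d` that satisfies the same condition everywhere. -/
def HolderOn {d : ℕ} (β C : ℝ) (η : Feature d → ℝ) (s : Set (Feature d)) : Prop :=
  ∀ x ∈ s, ∀ y ∈ s, |η x - η y| ≤ C * ‖x - y‖ ^ β

/-- The margin assumption with exponent `α` and constant `C`. -/
def Margin {d : ℕ} (Q : Law d) (ηQ : Feature d → ℝ) (α C : ℝ) : Prop :=
  ∀ t : ℝ, 0 < t → (marginal Q).real {x | 0 < |ηQ x - 1 / 2| ∧ |ηQ x - 1 / 2| < t} ≤ C * t ^ α

/-- Absolute continuity, with a density strictly between `μm` and `μp` on the support. -/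
def DensityBounds {d : ℕ} (P : Law d) (μm μp : ℝ) : Prop :=
  marginal P ≪ volume ∧
    ∀ᵐ x ∂(volume.restrict (supp P)),
      ENNReal.ofReal μm < (marginal P).rnDeriv volume x ∧
        (marginal P).rnDeriv volume x < ENNReal.ofReal μp

/-- Common support and strong density assumption. -/
def StrongDensity {d : ℕ} (P Q : Law d) (μm μp cμ rμ : ℝ) : Prop :=
  supp P = supp Q ∧
    (∀ x ∈ supp Q, ∀ r : ℝ, 0 < r → r ≤ rμ →
      ENNReal.ofReal cμ * volume (Metric.ball x r) ≤ volume (supp Q ∩ Metric.ball x r)) ∧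
    DensityBounds P μm μp ∧ DensityBounds Q μm μp

/-- The features take values in `[0,1]^d`. -/
def InCube {d : ℕ} (P : Law d) : Prop :=
  ∀ᵐ x ∂(marginal P), ∀ j, 0 ≤ x j ∧ x j ≤ 1

/-- The multi-source posterior drift class `Π`: tuples `((P_1, …, P_m), Q)`. -/
def driftClass (d m : ℕ) (α Cα β Cβ : ℝ) (γ Cγ : Fin m → ℝ) (μm μp cμ rμ : ℝ) :
    Set ((Fin m → Law d) × Law d) :=
  {θ | InCube θ.2 ∧ (∀ i, InCube (θ.1 i)) ∧
    (∀ i, StrongDensity (θ.1 i) θ.2 μm μp cμ rμ) ∧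
    ∃ (ηP : Fin m → Feature d → ℝ) (ηQ : Feature d → ℝ),
      (∀ i, IsRegression (θ.1 i) (ηP i)) ∧ IsRegression θ.2 ηQ ∧
      (∀ i, RelativeSignal (θ.1 i) θ.2 (ηP i) ηQ (γ i) (Cγ i)) ∧
      Margin θ.2 ηQ α Cα ∧
      HolderOn β Cβ ηQ (supp θ.2)}

/-- The data: `nP i` observations from the `i`-th source and `nQ` from the target. -/
abbrev Data (d m : ℕ) (nP : Fin m → ℕ) (nQ : ℕ) : Type :=
  ((i : Fin m) → Fin (nP i) → Obs d) × (Fin nQ → Obs d)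

/-- The law of the data: all observations independent, each with its own distribution. -/
def dataLaw {d m : ℕ} (nP : Fin m → ℕ) (nQ : ℕ) (θ : (Fin m → Law d) × Law d) :
    Measure (Data d m nP nQ) :=
  (Measure.pi fun i => Measure.pi fun _ : Fin (nP i) => (θ.1 i : Measure (Obs d))).prod
    (Measure.pi fun _ : Fin nQ => (θ.2 : Measure (Obs d)))

/-- An empirical classifier assigns a label to each point, given the data, jointly measurably. -/
def EmpiricalClassifier (d m : ℕ) (nP : Fin m → ℕ) (nQ : ℕ) : Type :=
  {f : Data d m nP nQ → Feature d → Bool // Measurable (Function.uncurry f)}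

/-- The expected excess risk under the target. The excess risk is nonnegative, so nothing is lost
by taking values in `[0, ∞]`. -/
def expectedExcessRisk {d m : ℕ} {nP : Fin m → ℕ} {nQ : ℕ} (f : EmpiricalClassifier d m nP nQ)
    (θ : (Fin m → Law d) × Law d) : ℝ≥0∞ :=
  ∫⁻ z, ENNReal.ofReal (excessRisk θ.2 (f.1 z)) ∂(dataLaw nP nQ θ)

/-- The minimax expected excess risk over a class of distribution tuples. -/
def minimaxRisk {d m : ℕ} (nP : Fin m → ℕ) (nQ : ℕ) (S : Set ((Fin m → Law d) × Law d)) : ℝ≥0∞ :=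
  ⨅ f : EmpiricalClassifier d m nP nQ, ⨆ θ ∈ S, expectedExcessRisk f θ

/-- The effective sample size `n_Q + ∑ i, n_{P_i} ^ ((2β + d) / (2γ_i β + d))`. -/
def effectiveSize (d : ℕ) {m : ℕ} (β : ℝ) (γ : Fin m → ℝ) (nP : Fin m → ℕ) (nQ : ℕ) : ℝ :=
  (nQ : ℝ) + ∑ i, (nP i : ℝ) ^ ((2 * β + d) / (2 * γ i * β + d))

end PosteriorDrift

end

/-!
The lower bound is Assouad's, on a hypercube of parameters whose marginals are all one and the same
law `U`. The support of `U` is a union of `N ^ d` small cubes, one in each cell of side `h = ℓ / N`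
of `[0, ℓ] ^ d`, separated by gaps of relative width `ε`; `U` is uniform on it. On a set `T` of
about `N ^ (d - α β)` cells the target regression function is `1/2 ± a` with `a` of order `h ^ β`,
and that of source `i` is `1/2 ± Cγ i * a ^ γ i` with the same signs; elsewhere all of them are
`1/2`.

The gaps make locally constant regression functions Hölder continuous on the support, so that there
are no small values of `|η - 1/2|` other than `0` and the margin condition only counts the cells in
`T` (`signParam_mem_driftClass`). A bump that vanishes continuously at the boundary of a cell would
satisfy the margin condition only for `α β ≤ 1`. The gaps cost an arbitrarily small part of the
constant in the density condition: by Fubini's theorem the regularity of the support is a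
one-dimensional statement (`volume_ball_inter_pi`, `volume_comb_inter_Ioo`), and the full cube has
the constant `2 ^ (-d)`.

Flipping the sign of one cell changes the law of one observation by `O(N ^ (-d) * b ^ 2)` in
`χ²`-divergence, where `b` is the deviation from `1/2`. If `N ^ (2 β + d)` is at least the effective
sample size, then by the choice of its exponents (`nP_le_rpow_of_effectiveSize_le`) the
`χ²`-divergence of the whole data stays bounded, no classifier can reliably tell the sign on any
cell (`ChiSqBound.testing`, `assouad`), and the excess risk is at least of order
`N ^ (d - α β) * a * N ^ (-d)`, that is, `N ^ (-β (1 + α))` (`le_minimaxRisk_of_grid`).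

The `χ²`-divergence is used in a dual form, `(∫ f dP')² ≤ M ∫ f² dP` for all `f ≥ 0`, which passes
to product measures by Tonelli's theorem without computing any density of the data
(`ChiSqBound.pi`).
-/

namespace PosteriorDrift

/-! ### Second moments of likelihood ratios -/

/-- `P'` has second moment of the likelihood ratio at most `M` with respect to `P` (that is,
`1 + χ²(P' ‖ P) ≤ M`), expressed in the dual form supplied by the Cauchy–Schwarz inequality. In
this form the bound is multiplicative over products by Tonelli's theorem alone. -/
def ChiSqBound {Ω : Type*} [MeasurableSpace Ω] (P' P : Measure Ω) (M : ℝ≥0∞) : Prop :=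
  ∀ f : Ω → ℝ≥0∞, Measurable f → (∫⁻ z, f z ∂P') ^ 2 ≤ M * ∫⁻ z, f z ^ 2 ∂P

namespace ChiSqBound

theorem mono {Ω : Type*} [MeasurableSpace Ω] {P' P : Measure Ω} {M M' : ℝ≥0∞}
    (h : ChiSqBound P' P M) (hM : M ≤ M') : ChiSqBound P' P M' :=
  fun f hf => (h f hf).trans (by gcongr)

theorem prod {Ω₁ Ω₂ : Type*} [MeasurableSpace Ω₁] [MeasurableSpace Ω₂]
    {P₁' P₁ : Measure Ω₁} {P₂' P₂ : Measure Ω₂} [SFinite P₁'] [SFinite P₁] [SFinite P₂']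
    [SFinite P₂] {M₁ M₂ : ℝ≥0∞} (h₁ : ChiSqBound P₁' P₁ M₁) (h₂ : ChiSqBound P₂' P₂ M₂) :
    ChiSqBound (P₁'.prod P₂') (P₁.prod P₂) (M₁ * M₂) := by
  intro f hf
  rw [lintegral_prod _ hf.aemeasurable, lintegral_prod _ (hf.pow_const 2).aemeasurable]
  calc (∫⁻ x, ∫⁻ y, f (x, y) ∂P₂' ∂P₁') ^ 2
      ≤ M₁ * ∫⁻ x, (∫⁻ y, f (x, y) ∂P₂') ^ 2 ∂P₁ := h₁ _ hf.lintegral_prod_right'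
    _ ≤ M₁ * ∫⁻ x, M₂ * ∫⁻ y, f (x, y) ^ 2 ∂P₂ ∂P₁ := by
        gcongr with x
        exact h₂ _ (hf.comp measurable_prodMk_left)
    _ = M₁ * M₂ * ∫⁻ x, ∫⁻ y, f (x, y) ^ 2 ∂P₂ ∂P₁ := by
        rw [lintegral_const_mul _ (hf.pow_const 2).lintegral_prod_right', mul_assoc]

theorem pi {ι : Type*} [Fintype ι] {X : ι → Type*} [∀ i, MeasurableSpace (X i)]
    {P' P : ∀ i, Measure (X i)} [∀ i, IsProbabilityMeasure (P' i)]
    [∀ i, IsProbabilityMeasure (P i)] {M : ι → ℝ≥0∞} (h : ∀ i, ChiSqBound (P' i) (P i) (M i)) :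
    ChiSqBound (Measure.pi P') (Measure.pi P) (∏ i, M i) := by
  classical
  intro f hf
  have key : ∀ (s : Finset ι) (x : ∀ i, X i),
      (∫⋯∫⁻_s, f ∂P') x ^ 2 ≤ (∏ i ∈ s, M i) * (∫⋯∫⁻_s, (fun z => f z ^ 2) ∂P) x := by
    intro s
    induction s using Finset.induction_on with
    | empty => intro x; simp
    | insert i s hi ih =>
      intro x
      rw [lmarginal_insert _ hf hi, lmarginal_insert _ (hf.pow_const 2) hi,
        Finset.prod_insert hi]
      calc (∫⁻ y, (∫⋯∫⁻_s, f ∂P') (Function.update x i y) ∂P' i) ^ 2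
          ≤ M i * ∫⁻ y, (∫⋯∫⁻_s, f ∂P') (Function.update x i y) ^ 2 ∂P i :=
            h i _ ((hf.lmarginal P').comp (measurable_update x))
        _ ≤ M i * ∫⁻ y, (∏ j ∈ s, M j) *
              (∫⋯∫⁻_s, (fun z => f z ^ 2) ∂P) (Function.update x i y) ∂P i := by
            gcongr with y
            exact ih _
        _ = _ := by
            have hm : Measurable fun y =>
                (∫⋯∫⁻_s, (fun z => f z ^ 2) ∂P) (Function.update x i y) :=
              ((hf.pow_const 2).lmarginal P).comp (measurable_update x)
            rw [lintegral_const_mul _ hm, mul_assoc]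
  have hne : Nonempty (∀ i, X i) :=
    ⟨fun i => (nonempty_of_isProbabilityMeasure (P i)).some⟩
  obtain ⟨x⟩ := hne
  have := key Finset.univ x
  rwa [← lintegral_eq_lmarginal_univ x, ← lintegral_eq_lmarginal_univ x] at this

/-- Two-point testing bound: no test separates two laws whose likelihood ratio has a bounded second
moment. -/
theorem testing {Ω : Type*} [MeasurableSpace Ω] {P' P : Measure Ω} [IsProbabilityMeasure P']
    {M : ℝ} (hM : 1 ≤ M) (h : ChiSqBound P' P (ENNReal.ofReal M)) {E : Set Ω}
    (hE : MeasurableSet E) :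
    ENNReal.ofReal (1 / (4 * M)) ≤ P E + P' Eᶜ := by
  rcases eq_or_ne (P E) ⊤ with hP | hP
  · simp [hP]
  have h1 : P' E ^ 2 ≤ ENNReal.ofReal M * P E := by
    have h2 := h (E.indicator 1) (measurable_one.indicator hE)
    have h3 : ∀ z, E.indicator (1 : Ω → ℝ≥0∞) z ^ 2 = E.indicator 1 z := by
      intro z; by_cases hz : z ∈ E <;> simp [hz]
    simpa only [h3, lintegral_indicator_one hE] using h2
  have hP' : P' E ≠ ⊤ := measure_ne_top _ _
  rw [prob_compl_eq_one_sub hE]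
  obtain ⟨p, hp0, hp⟩ : ∃ p : ℝ, 0 ≤ p ∧ P E = ENNReal.ofReal p :=
    ⟨(P E).toReal, ENNReal.toReal_nonneg, (ENNReal.ofReal_toReal hP).symm⟩
  obtain ⟨q, hq0, hq⟩ : ∃ q : ℝ, 0 ≤ q ∧ P' E = ENNReal.ofReal q :=
    ⟨(P' E).toReal, ENNReal.toReal_nonneg, (ENNReal.ofReal_toReal hP').symm⟩
  have hq1 : q ≤ 1 := by
    have : P' E ≤ 1 := prob_le_one
    rwa [hq, ENNReal.ofReal_le_one] at this
  have h4 : q ^ 2 ≤ M * p := by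
    rw [hp, hq, ← ENNReal.ofReal_pow hq0, ← ENNReal.ofReal_mul (by linarith)] at h1
    exact (ENNReal.ofReal_le_ofReal_iff (by positivity)).1 h1
  rw [hp, hq, ← ENNReal.ofReal_one, ← ENNReal.ofReal_sub _ hq0,
    ← ENNReal.ofReal_add hp0 (by linarith)]
  apply ENNReal.ofReal_le_ofReal
  rw [div_le_iff₀ (by positivity)]
  -- `4 M p ≥ 4 q²`, and `4 q² + 4 (1 - q) ≥ 3`
  nlinarith [sq_nonneg (q - 1 / 2), mul_le_mul_of_nonneg_right hM (sub_nonneg.2 hq1)]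

end ChiSqBound

/-! ### Laws of labelled observations -/

/-- The law of `(X, Y)` for which `X` has law `U` and `Y = 1` has conditional probability `η X`. -/
noncomputable def labelMeasure {d : ℕ} (U : Measure (Feature d)) (η : Feature d → ℝ) :
    Measure (Obs d) :=
  (U.prod Measure.count).withDensity fun z =>
    ENNReal.ofReal (if z.2 = true then η z.1 else 1 - η z.1)

section LabelMeasure

variable {d : ℕ} {U : Measure (Feature d)} {η : Feature d → ℝ}

theorem measurable_labelDensity (hη : Measurable η) :
    Measurable fun z : Obs d => if z.2 = true then η z.1 else 1 - η z.1 :=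
  Measurable.ite (measurable_snd (measurableSet_singleton true)) (hη.comp measurable_fst)
    (measurable_const.sub (hη.comp measurable_fst))

theorem lintegral_prod_count [SFinite U] {f : Obs d → ℝ≥0∞} (hf : Measurable f) :
    ∫⁻ z, f z ∂(U.prod Measure.count) = ∫⁻ x, f (x, true) + f (x, false) ∂U := by
  rw [lintegral_prod _ hf.aemeasurable]
  congr with x
  rw [lintegral_count, tsum_fintype, Fintype.sum_bool]

theorem lintegral_labelMeasure [SFinite U] (hη : Measurable η) {f : Obs d → ℝ≥0∞}
    (hf : Measurable f) :
    ∫⁻ z, f z ∂(labelMeasure U η) =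
      ∫⁻ x, ENNReal.ofReal (η x) * f (x, true) + ENNReal.ofReal (1 - η x) * f (x, false) ∂U := by
  have hm := (measurable_labelDensity hη).ennreal_ofReal
  rw [labelMeasure, lintegral_withDensity_eq_lintegral_mul _ hm hf,
    lintegral_prod_count (hm.mul hf)]
  simp

theorem ofReal_add_ofReal_one_sub {p : ℝ} (hp : 0 ≤ p ∧ p ≤ 1) :
    ENNReal.ofReal p + ENNReal.ofReal (1 - p) = 1 := by
  rw [← ENNReal.ofReal_add hp.1 (by linarith [hp.2])]
  simp

theorem isProbabilityMeasure_labelMeasure [IsProbabilityMeasure U] (hη : Measurable η)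
    (h01 : ∀ x, 0 ≤ η x ∧ η x ≤ 1) : IsProbabilityMeasure (labelMeasure U η) := by
  constructor
  rw [← lintegral_one, lintegral_labelMeasure hη measurable_const]
  simp [ofReal_add_ofReal_one_sub (h01 _)]

theorem labelMeasure_fst [IsProbabilityMeasure U] (hη : Measurable η)
    (h01 : ∀ x, 0 ≤ η x ∧ η x ≤ 1) : (labelMeasure U η).fst = U := by
  ext s hs
  rw [Measure.fst_apply hs, ← lintegral_indicator_one (measurable_fst hs),
    lintegral_labelMeasure hη (measurable_one.indicator (measurable_fst hs)),
    ← lintegral_indicator_one hs]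
  congr with x
  by_cases hx : x ∈ s <;> simp [hx, ofReal_add_ofReal_one_sub (h01 x)]

theorem labelMeasure_prod_true [IsProbabilityMeasure U] (hη : Measurable η)
    {s : Set (Feature d)} (hs : MeasurableSet s) :
    labelMeasure U η (s ×ˢ {true}) = ∫⁻ x in s, ENNReal.ofReal (η x) ∂U := by
  have hst : MeasurableSet (s ×ˢ ({true} : Set Bool)) := hs.prod (measurableSet_singleton _)
  rw [← lintegral_indicator_one hst, lintegral_labelMeasure hη (measurable_one.indicator hst),
    ← lintegral_indicator hs]
  congr with x
  by_cases hx : x ∈ s <;> simp [hx]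

theorem condKernel_labelMeasure [IsProbabilityMeasure U] (hη : Measurable η)
    (h01 : ∀ x, 0 ≤ η x ∧ η x ≤ 1) [IsFiniteMeasure (labelMeasure U η)] :
    (fun x => ((labelMeasure U η).condKernel x).real {true}) =ᵐ[U] η := by
  have hk : Measurable fun x => (labelMeasure U η).condKernel x {true} :=
    ProbabilityTheory.Kernel.measurable_coe _ (measurableSet_singleton _)
  have h : (fun x => (labelMeasure U η).condKernel x {true}) =ᵐ[U]
      fun x => ENNReal.ofReal (η x) := by
    refine ae_eq_of_forall_setLIntegral_eq_of_sigmaFinite hk hη.ennreal_ofReal fun s hs _ => ?_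
    have := Measure.setLIntegral_condKernel_eq_measure_prod (ρ := labelMeasure U η) hs
      (measurableSet_singleton true)
    rw [labelMeasure_fst hη h01] at this
    rw [this, labelMeasure_prod_true hη hs]
  filter_upwards [h] with x hx
  rw [Measure.real, hx, ENNReal.toReal_ofReal (h01 x).1]

end LabelMeasure

/-- `labelMeasure` as an element of the space of laws. -/
noncomputable def labelLaw {d : ℕ} (U : Measure (Feature d)) [IsProbabilityMeasure U]
    (η : Feature d → ℝ) (hη : Measurable η) (h01 : ∀ x, 0 ≤ η x ∧ η x ≤ 1) : Law d :=
  ⟨labelMeasure U η, isProbabilityMeasure_labelMeasure hη h01⟩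

section LabelLaw

variable {d : ℕ} {U : Measure (Feature d)} [IsProbabilityMeasure U] {η : Feature d → ℝ}
  (hη : Measurable η) (h01 : ∀ x, 0 ≤ η x ∧ η x ≤ 1)

theorem coe_labelLaw : (labelLaw U η hη h01 : Measure (Obs d)) = labelMeasure U η := rfl

theorem marginal_labelLaw : marginal (labelLaw U η hη h01) = U := labelMeasure_fst hη h01

theorem supp_labelLaw : supp (labelLaw U η hη h01) = U.support := by
  rw [supp, marginal_labelLaw]

theorem regression_labelLaw : regression (labelLaw U η hη h01) =ᵐ[U] η := by
  have := isProbabilityMeasure_labelMeasure (U := U) hη h01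
  filter_upwards [condKernel_labelMeasure hη h01, Measure.support_mem_ae (μ := U)] with x hx hs
  rw [regression, if_pos (by rwa [supp_labelLaw])]
  exact hx

theorem isRegression_labelLaw (hoff : ∀ x, x ∉ U.support → η x = 1 / 2) :
    IsRegression (labelLaw U η hη h01) η := by
  refine ⟨hη, h01, by rwa [supp_labelLaw], ?_⟩
  rw [marginal_labelLaw]
  exact (regression_labelLaw hη h01).symm

/-- The probability of misclassification, with the error made at each point written as the
unavoidable error `min η (1 - η)` plus `|2η - 1|` where the classifier differs from the Bayes
rule. -/
theorem labelMeasure_error (hη : Measurable η) (h01 : ∀ x, 0 ≤ η x ∧ η x ≤ 1)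
    {f : Feature d → Bool} (hf : Measurable f) :
    labelMeasure U η {z | z.2 ≠ f z.1} =
      ∫⁻ x, ENNReal.ofReal (min (η x) (1 - η x)) ∂U +
      ∫⁻ x, {x | f x ≠ decide (1 / 2 < η x)}.indicator
        (fun x => ENNReal.ofReal |2 * η x - 1|) x ∂U := by
  have hs : MeasurableSet {z : Obs d | z.2 ≠ f z.1} :=
    (measurableSet_eq_fun measurable_snd (hf.comp measurable_fst)).compl
  rw [← lintegral_indicator_one hs, lintegral_labelMeasure hη (measurable_one.indicator hs)]
  have hmm : Measurable fun x => ENNReal.ofReal (min (η x) (1 - η x)) :=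
    (hη.min (measurable_const.sub hη)).ennreal_ofReal
  rw [← lintegral_add_left hmm]
  congr with x
  obtain ⟨h0, h1⟩ := h01 x
  by_cases hlt : 1 / 2 < η x
  · have hmin : min (η x) (1 - η x) = 1 - η x := min_eq_right (by linarith)
    rcases hfx : f x with _ | _
    · simp only [Set.indicator, Set.mem_ofPred_eq, hfx, hlt, hmin]
      rw [abs_of_nonneg (by linarith)]
      simp only [decide_true, ne_eq, Bool.false_eq_true, Bool.true_eq_false, not_false_eq_true,
        if_true, not_true, if_false, Pi.one_apply, mul_one, mul_zero, add_zero]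
      rw [← ENNReal.ofReal_add (by linarith) (by linarith)]
      ring_nf
    · have hle : ¬ η x ≤ 2⁻¹ := by rw [not_le]; linarith
      simp [Set.indicator, hfx, hmin, hle]
  · have hmin : min (η x) (1 - η x) = η x := min_eq_left (by linarith)
    rcases hfx : f x with _ | _
    · have hle : ¬ 2⁻¹ < η x := by rw [not_lt]; linarith
      simp [Set.indicator, hfx, hmin, hle]
    · simp only [Set.indicator, Set.mem_ofPred_eq, hfx, hlt, hmin]
      rw [abs_of_nonpos (by linarith)]
      simp only [decide_false, ne_eq, Bool.false_eq_true, Bool.true_eq_false, not_false_eq_true,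
        if_true, not_true, if_false, Pi.one_apply, mul_one, mul_zero, zero_add]
      rw [← ENNReal.ofReal_add (by linarith) (by linarith)]
      ring_nf

theorem ofReal_excessRisk_labelLaw {f : Feature d → Bool} (hf : Measurable f) :
    ENNReal.ofReal (excessRisk (labelLaw U η hη h01) f) =
      ∫⁻ x, {x | f x ≠ decide (1 / 2 < η x)}.indicator
        (fun x => ENNReal.ofReal |2 * η x - 1|) x ∂U := by
  have := isProbabilityMeasure_labelMeasure (U := U) hη h01
  have hb : risk (labelLaw U η hη h01) (bayes (labelLaw U η hη h01)) =
      (labelMeasure U η).real {z | z.2 ≠ decide (1 / 2 < η z.1)} := by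
    refine measureReal_congr ?_
    have h1 : ∀ᵐ z ∂(labelMeasure U η), regression (labelLaw U η hη h01) z.1 = η z.1 := by
      have h2 := regression_labelLaw (U := U) hη h01
      refine ae_of_ae_map (p := fun x => regression (labelLaw U η hη h01) x = η x)
        measurable_fst.aemeasurable ?_
      change ∀ᵐ x ∂(labelMeasure U η).fst, _
      rwa [labelMeasure_fst hη h01]
    rw [coe_labelLaw]
    filter_upwards [h1] with z hz
    have : bayes (labelLaw U η hη h01) z.1 = decide (1 / 2 < η z.1) := by
      simp only [bayes, hz]
    change (z.2 ≠ _) = (z.2 ≠ _)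
    rw [this]
  have hdec : Measurable fun x => decide (1 / 2 < η x) :=
    measurable_to_bool (by
      convert hη (measurableSet_Ioi (a := (1 / 2 : ℝ))) using 1
      ext x; simp)
  rw [excessRisk, hb, risk, Measure.real, Measure.real, coe_labelLaw,
    labelMeasure_error hη h01 hf, labelMeasure_error hη h01 hdec]
  simp only [ne_eq, not_true_eq_false, Set.ofPred_false, Set.indicator_empty, lintegral_zero,
    add_zero]
  set A := ∫⁻ x, ENNReal.ofReal (min (η x) (1 - η x)) ∂U
  set B := ∫⁻ x, {x | ¬ f x = decide (1 / 2 < η x)}.indicator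
        (fun x => ENNReal.ofReal |2 * η x - 1|) x ∂U
  have hAB : A + B ≠ ⊤ := by
    have h := labelMeasure_error (U := U) hη h01 hf
    exact h ▸ measure_ne_top (labelMeasure U η) _
  rw [ENNReal.toReal_add (by aesop) (by aesop), add_sub_cancel_left,
    ENNReal.ofReal_toReal (by aesop)]

end LabelLaw

/-- The Cauchy–Schwarz inequality for nonnegative functions. -/
theorem sq_lintegral_mul_le {Ω : Type*} [MeasurableSpace Ω] (μ : Measure Ω) {f g : Ω → ℝ≥0∞}
    (hf : Measurable f) (hg : Measurable g) :
    (∫⁻ x, f x * g x ∂μ) ^ 2 ≤ (∫⁻ x, f x ^ 2 ∂μ) * ∫⁻ x, g x ^ 2 ∂μ := by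
  have h := ENNReal.lintegral_mul_le_Lp_mul_Lq μ Real.HolderConjugate.two_two hf.aemeasurable
    hg.aemeasurable
  have hsq : ∀ a : ℝ≥0∞, (a ^ (1 / 2 : ℝ)) ^ 2 = a := by
    intro a
    rw [← ENNReal.rpow_natCast, ← ENNReal.rpow_mul]
    norm_num
  calc (∫⁻ x, f x * g x ∂μ) ^ 2 ≤ _ := pow_le_pow_left' h 2
    _ = _ := by
      rw [mul_pow, hsq, hsq]
      simp only [ENNReal.rpow_two]

/-- Reflecting a Bernoulli parameter within `b` of `1/2` changes the law by `O(b²)` in `χ²`. -/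
theorem sq_div_add_sq_div_le {p b : ℝ} (hb : b ≤ 1 / 4) (hp : |p - 1 / 2| ≤ b) :
    (1 - p) ^ 2 / p + p ^ 2 / (1 - p) ≤ 1 + 32 * b ^ 2 := by
  obtain ⟨h1, h2⟩ := abs_le.1 hp
  have hp0 : 1 / 4 ≤ p := by linarith
  have hp1 : p ≤ 3 / 4 := by linarith
  have hsq : (p - 1 / 2) ^ 2 ≤ b ^ 2 := sq_le_sq' (by linarith) (by linarith)
  have hsq' : b ^ 2 ≤ 1 / 16 := by nlinarith [abs_nonneg (p - 1 / 2)]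
  rw [div_add_div _ _ (by linarith) (by linarith), div_le_iff₀ (by nlinarith)]
  have e : p * (1 - p) = 1 / 4 - (p - 1 / 2) ^ 2 := by ring
  have e2 : (1 - p) ^ 2 * (1 - p) + p * p ^ 2 = 1 / 4 + 3 * (p - 1 / 2) ^ 2 := by ring
  rw [e, e2]
  nlinarith [sq_nonneg b, sq_nonneg (p - 1 / 2)]

/-- If `η'` agrees with `η` off `E` and is its reflection about `1/2` on `E`, where `η` is within
`b` of `1/2`, then one labelled observation carries `χ²` information at most `32 b² U(E)`. -/
theorem chiSqBound_labelMeasure {d : ℕ} {U : Measure (Feature d)} [IsProbabilityMeasure U]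
    {η η' : Feature d → ℝ} (hη : Measurable η) (hη' : Measurable η') {E : Set (Feature d)}
    (hE : MeasurableSet E) {b : ℝ} (hb : b ≤ 1 / 4) (h01 : ∀ x, 0 < η x ∧ η x < 1)
    (hoff : ∀ x, x ∉ E → η' x = η x) (hon : ∀ x ∈ E, η' x = 1 - η x ∧ |η x - 1 / 2| ≤ b) :
    ChiSqBound (labelMeasure U η') (labelMeasure U η)
      (ENNReal.ofReal (1 + 32 * b ^ 2 * U.real E)) := by
  intro f hf
  set g : Obs d → ℝ := fun z => if z.2 = true then η z.1 else 1 - η z.1 with hg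
  set g' : Obs d → ℝ := fun z => if z.2 = true then η' z.1 else 1 - η' z.1 with hg'
  have hgm : Measurable g := measurable_labelDensity hη
  have hgm' : Measurable g' := measurable_labelDensity hη'
  have hg0 : ∀ z, 0 < g z := by
    rintro ⟨x, y⟩
    cases y <;> simp [hg, (h01 x).1, (h01 x).2]
  have hη'01 : ∀ x, 0 < η' x ∧ η' x < 1 := by
    intro x
    by_cases hx : x ∈ E
    · rw [(hon x hx).1]; exact ⟨by linarith [(h01 x).2], by linarith [(h01 x).1]⟩
    · rw [hoff x hx]; exact h01 x
  have hg0' : ∀ z, 0 < g' z := by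
    rintro ⟨x, y⟩
    cases y <;> simp [hg', (hη'01 x).1, (hη'01 x).2]
  rw [labelMeasure, labelMeasure,
    lintegral_withDensity_eq_lintegral_mul _ hgm'.ennreal_ofReal hf,
    lintegral_withDensity_eq_lintegral_mul _ hgm.ennreal_ofReal (hf.pow_const 2)]
  simp only [Pi.mul_apply]
  -- Cauchy–Schwarz is applied to `g' f = (g' / √g) * (√g f)`
  have hsplit : ∀ z, ENNReal.ofReal (g' z) * f z =
      ENNReal.ofReal (g' z / √(g z)) * (ENNReal.ofReal √(g z) * f z) := by
    intro z
    rw [← mul_assoc, ← ENNReal.ofReal_mul (div_nonneg (hg0' z).le (Real.sqrt_nonneg _)),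
      div_mul_cancel₀ _ (Real.sqrt_pos.2 (hg0 z)).ne']
  have hk : ∀ z, ENNReal.ofReal (g' z / √(g z)) ^ 2 = ENNReal.ofReal (g' z ^ 2 / g z) := by
    intro z
    rw [← ENNReal.ofReal_pow (div_nonneg (hg0' z).le (Real.sqrt_nonneg _)), div_pow,
      Real.sq_sqrt (hg0 z).le]
  have hh : ∀ z, (ENNReal.ofReal √(g z) * f z) ^ 2 = ENNReal.ofReal (g z) * f z ^ 2 := by
    intro z
    rw [mul_pow, ← ENNReal.ofReal_pow (Real.sqrt_nonneg _), Real.sq_sqrt (hg0 z).le]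
  have hcs := sq_lintegral_mul_le (U.prod Measure.count)
    (hgm'.div hgm.sqrt).ennreal_ofReal (hgm.sqrt.ennreal_ofReal.mul hf)
  simp only [Pi.div_apply, Pi.mul_apply] at hcs
  simp only [← hsplit, hk, hh] at hcs
  refine hcs.trans ?_
  gcongr
  have hkm : Measurable fun z => ENNReal.ofReal (g' z ^ 2 / g z) :=
    ((hgm'.pow_const 2).div hgm).ennreal_ofReal
  rw [lintegral_prod_count hkm]
  calc ∫⁻ x, ENNReal.ofReal (g' (x, true) ^ 2 / g (x, true)) +
        ENNReal.ofReal (g' (x, false) ^ 2 / g (x, false)) ∂U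
      ≤ ∫⁻ x, 1 + E.indicator (fun _ => ENNReal.ofReal (32 * b ^ 2)) x ∂U := by
        refine lintegral_mono fun x => ?_
        obtain ⟨h0, h1⟩ := h01 x
        simp only [hg, hg', if_true, Bool.false_eq_true, if_false]
        have hp : 0 < 1 - η x := by linarith
        rw [← ENNReal.ofReal_add (by positivity) (by positivity)]
        by_cases hx : x ∈ E
        · rw [Set.indicator_of_mem hx, (hon x hx).1, ← ENNReal.ofReal_one,
            ← ENNReal.ofReal_add zero_le_one (by positivity), sub_sub_cancel]
          exact ENNReal.ofReal_le_ofReal (sq_div_add_sq_div_le hb (hon x hx).2)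
        · rw [Set.indicator_of_notMem hx, hoff x hx, add_zero, ← ENNReal.ofReal_one]
          apply ENNReal.ofReal_le_ofReal
          apply le_of_eq
          field_simp
          ring
    _ = ENNReal.ofReal (1 + 32 * b ^ 2 * U.real E) := by
        rw [lintegral_add_left measurable_const, lintegral_indicator_const hE, lintegral_one,
          measure_univ, ENNReal.ofReal_add zero_le_one (by positivity), ENNReal.ofReal_one,
          ENNReal.ofReal_mul (by positivity : (0 : ℝ) ≤ 32 * b ^ 2), ofReal_measureReal]

/-! ### Assouad's lemma on a hypercube of sign patterns -/

open scoped symmDiff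

theorem symmDiff_singleton_mem_powerset {ι : Type*} [DecidableEq ι] {T A : Finset ι} {k : ι}
    (hk : k ∈ T) (hA : A ∈ T.powerset) : A ∆ {k} ∈ T.powerset := by
  rw [Finset.mem_powerset] at hA ⊢
  intro j hj
  rcases Finset.mem_symmDiff.1 hj with h | h
  · exact hA h.1
  · rw [Finset.mem_singleton.1 h.1]; exact hk

/-- Averaging over a hypercube may be done in pairs of neighbours in direction `k`. -/
theorem card_mul_le_two_mul_sum_powerset {ι : Type*} [DecidableEq ι] {T : Finset ι} {k : ι}
    (hk : k ∈ T) {g : Finset ι → ℝ≥0∞} {C : ℝ≥0∞}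
    (h : ∀ A ∈ T.powerset, C ≤ g A + g (A ∆ {k})) :
    2 ^ T.card * C ≤ 2 * ∑ A ∈ T.powerset, g A := by
  have hflip : ∑ A ∈ T.powerset, g (A ∆ {k}) = ∑ A ∈ T.powerset, g A :=
    Finset.sum_nbij' (fun A => A ∆ {k}) (fun A => A ∆ {k})
      (fun A hA => symmDiff_singleton_mem_powerset hk hA)
      (fun A hA => symmDiff_singleton_mem_powerset hk hA)
      (fun A _ => symmDiff_symmDiff_cancel_right _ _)
      (fun A _ => symmDiff_symmDiff_cancel_right _ _) (fun _ _ => rfl)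
  calc (2 : ℝ≥0∞) ^ T.card * C = ∑ _A ∈ T.powerset, C := by
        rw [Finset.sum_const, Finset.card_powerset, nsmul_eq_mul]; norm_cast
    _ ≤ ∑ A ∈ T.powerset, (g A + g (A ∆ {k})) := Finset.sum_le_sum h
    _ = 2 * ∑ A ∈ T.powerset, g A := by rw [Finset.sum_add_distrib, hflip, two_mul]

/-- Assouad's lemma. Data laws are indexed by the vertices `A ⊆ T` of a hypercube, neighbouring laws
are close in `χ²`, and a classifier has to decide on each cell `s k` whether `k ∈ A`. -/
theorem assouad {Z X ι : Type*} [MeasurableSpace Z] [MeasurableSpace X] [DecidableEq ι]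
    {T : Finset ι} {D : Finset ι → Measure Z} [∀ A, IsProbabilityMeasure (D A)]
    {U : Measure X} [SFinite U] {s : ι → Set X} {M : ℝ} (hM : 1 ≤ M)
    (hD : ∀ A ∈ T.powerset, ∀ k ∈ T, ChiSqBound (D (A ∆ {k})) (D A) (ENNReal.ofReal M))
    {w : ℝ≥0∞} (hw : ∀ k ∈ T, w ≤ U (s k))
    {f : Z → X → Bool} (hf : Measurable (Function.uncurry f)) :
    2 ^ T.card * (T.card * (ENNReal.ofReal (1 / (4 * M)) * w)) ≤
      2 * ∑ A ∈ T.powerset, ∑ k ∈ T,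
        ∫⁻ z, ∫⁻ x in s k, {x | f z x ≠ decide (k ∈ A)}.indicator 1 x ∂U ∂(D A) := by
  rw [Finset.sum_comm, Finset.mul_sum, ← nsmul_eq_mul, ← Finset.sum_const, Finset.mul_sum]
  refine Finset.sum_le_sum fun k hk => card_mul_le_two_mul_sum_powerset hk fun A hA => ?_
  have hset : ∀ y : Bool, MeasurableSet {p : Z × X | f p.1 p.2 ≠ y} := fun y =>
    (hf (measurableSet_singleton y)).compl
  have hswap : ∀ (y : Bool) (B : Finset ι),
      ∫⁻ z, ∫⁻ x in s k, {x | f z x ≠ y}.indicator 1 x ∂U ∂(D B) =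
        ∫⁻ x in s k, D B {z | f z x ≠ y} ∂U := by
    intro y B
    have hm : Measurable ({p : Z × X | f p.1 p.2 ≠ y}.indicator (1 : Z × X → ℝ≥0∞)) :=
      measurable_one.indicator (hset y)
    rw [lintegral_lintegral_swap (f := fun z x => {x | f z x ≠ y}.indicator (1 : X → ℝ≥0∞) x)
      hm.aemeasurable]
    congr with x
    have hx : MeasurableSet {z | f z x ≠ y} := measurable_prodMk_right (hset y)
    rw [← lintegral_indicator_one hx]
    rfl
  have hm : Measurable fun x => D A {z | f z x ≠ decide (k ∈ A)} :=
    measurable_measure_prodMk_right (hset _)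
  rw [hswap, hswap, ← lintegral_add_left hm]
  calc ENNReal.ofReal (1 / (4 * M)) * w ≤ ENNReal.ofReal (1 / (4 * M)) * U (s k) := by
        gcongr; exact hw k hk
    _ = ∫⁻ _ in s k, ENNReal.ofReal (1 / (4 * M)) ∂U := by rw [setLIntegral_const]
    _ ≤ _ := by
        refine lintegral_mono fun x => ?_
        have hx : MeasurableSet {z | f z x ≠ decide (k ∈ A)} :=
          measurable_prodMk_right (hset _)
        refine ((hD A hA k hk).testing hM hx).trans_eq ?_
        congr 2
        ext z
        by_cases hkA : k ∈ A <;> simp [Finset.mem_symmDiff, hkA]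

/-- The sign pattern that is `+1` on the cells in `A`, `-1` on the cells in `T \ A` and `0`
elsewhere; the cells are the intersections of `Ω` with the fibres of `c`. -/
noncomputable def cellSign {X ι : Type*} [DecidableEq ι] (Ω : Set X) (c : X → ι)
    (T A : Finset ι) (x : X) : ℝ :=
  Ω.indicator (fun x => if c x ∈ T then (if c x ∈ A then 1 else -1) else 0) x

/-- The regression function with deviation `b` from `1/2` and the signs of `cellSign`. -/
noncomputable def signRegression {X ι : Type*} [DecidableEq ι] (Ω : Set X) (c : X → ι)
    (T A : Finset ι) (b : ℝ) (x : X) : ℝ :=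
  1 / 2 + b * cellSign Ω c T A x

section Sign

variable {X ι : Type*} [DecidableEq ι] {Ω : Set X} {c : X → ι} {T A : Finset ι} {b : ℝ}

theorem cellSign_cases (x : X) :
    (x ∈ Ω ∧ c x ∈ T ∧ (cellSign Ω c T A x = 1 ∨ cellSign Ω c T A x = -1)) ∨
      cellSign Ω c T A x = 0 := by
  by_cases hx : x ∈ Ω
  · by_cases hT : c x ∈ T
    · by_cases hA : c x ∈ A <;> simp [cellSign, hx, hT, hA]
    · simp [cellSign, hx, hT]
  · simp [cellSign, hx]

theorem abs_cellSign_le (x : X) : |cellSign Ω c T A x| ≤ 1 := by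
  rcases cellSign_cases (Ω := Ω) (c := c) (T := T) (A := A) x with ⟨-, -, h | h⟩ | h <;> simp [h]

theorem measurable_cellSign [MeasurableSpace X] [MeasurableSpace ι] [DiscreteMeasurableSpace ι]
    (hΩ : MeasurableSet Ω) (hc : Measurable c) : Measurable (cellSign Ω c T A) :=
  ((Measurable.of_discrete (f := fun k : ι =>
    (if k ∈ T then (if k ∈ A then (1 : ℝ) else -1) else 0))).comp hc).indicator hΩ

theorem measurable_signRegression [MeasurableSpace X] [MeasurableSpace ι]
    [DiscreteMeasurableSpace ι] (hΩ : MeasurableSet Ω) (hc : Measurable c) :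
    Measurable (signRegression Ω c T A b) :=
  ((measurable_cellSign hΩ hc).const_mul b).const_add _

theorem signRegression_sub (x : X) :
    signRegression Ω c T A b x - 1 / 2 = b * cellSign Ω c T A x := by
  simp [signRegression]

theorem abs_signRegression_sub_le (hb : 0 ≤ b) (x : X) :
    |signRegression Ω c T A b x - 1 / 2| ≤ b := by
  rw [signRegression_sub, abs_mul, abs_of_nonneg hb]
  exact mul_le_of_le_one_right hb (abs_cellSign_le x)

theorem signRegression_mem (hb : 0 ≤ b) (hb' : b ≤ 1 / 4) (x : X) :
    0 < signRegression Ω c T A b x ∧ signRegression Ω c T A b x < 1 := by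
  have := abs_le.1 (abs_signRegression_sub_le (Ω := Ω) (c := c) (T := T) (A := A) hb x)
  constructor <;> linarith [this.1, this.2]

theorem cellSign_flip_of_mem {k : ι} {x : X} (hx : x ∈ Ω ∩ c ⁻¹' {k}) :
    cellSign Ω c T (A ∆ {k}) x = -cellSign Ω c T A x := by
  have h1 : c x = k := hx.2
  by_cases hT : k ∈ T <;> by_cases hA : k ∈ A <;>
    simp [cellSign, hx.1, h1, hT, hA, Finset.mem_symmDiff]

theorem cellSign_flip_of_notMem {k : ι} {x : X} (hx : x ∉ Ω ∩ c ⁻¹' {k}) :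
    cellSign Ω c T (A ∆ {k}) x = cellSign Ω c T A x := by
  by_cases hΩ : x ∈ Ω
  · have h1 : c x ≠ k := fun h => hx ⟨hΩ, h⟩
    simp [cellSign, hΩ, h1, Finset.mem_symmDiff]
  · simp [cellSign, hΩ]

end Sign

section Hypercube

variable {d : ℕ} {ι : Type*} [DecidableEq ι] [MeasurableSpace ι] [DiscreteMeasurableSpace ι]
  {Ω : Set (Feature d)} {c : Feature d → ι} {T A : Finset ι}
  {U : Measure (Feature d)} [IsProbabilityMeasure U]

/-- The law of an observation with marginal `U` and regression function
`signRegression`. -/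
noncomputable def signLaw (U : Measure (Feature d)) [IsProbabilityMeasure U]
    (hΩ : MeasurableSet Ω) (hc : Measurable c) (T A : Finset ι) {b : ℝ}
    (hb : 0 ≤ b) (hb' : b ≤ 1 / 4) : Law d :=
  labelLaw U (signRegression Ω c T A b) (measurable_signRegression hΩ hc)
    fun x => ⟨(signRegression_mem hb hb' x).1.le, (signRegression_mem hb hb' x).2.le⟩

theorem chiSqBound_signLaw (hΩ : MeasurableSet Ω) (hc : Measurable c) {b : ℝ} (hb : 0 ≤ b)
    (hb' : b ≤ 1 / 4) (k : ι) :
    ChiSqBound (signLaw U hΩ hc T (A ∆ {k}) hb hb' : Measure (Obs d))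
      (signLaw U hΩ hc T A hb hb' : Measure (Obs d))
      (ENNReal.ofReal (1 + 32 * b ^ 2 * U.real (Ω ∩ c ⁻¹' {k}))) := by
  refine chiSqBound_labelMeasure (measurable_signRegression hΩ hc)
    (measurable_signRegression hΩ hc) (hΩ.inter (hc (measurableSet_singleton k))) hb'
    (signRegression_mem hb hb') (fun x hx => ?_) (fun x hx => ⟨?_, abs_signRegression_sub_le hb x⟩)
  · rw [signRegression, signRegression, cellSign_flip_of_notMem hx]
  · rw [signRegression, signRegression, cellSign_flip_of_mem hx]
    ring

/-- The excess risk counts, with weight `2 a`, the part of each cell on which the classifier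
misses the sign. -/
theorem sum_le_excessRisk_signLaw (hΩ : MeasurableSet Ω) (hc : Measurable c) {a : ℝ} (ha : 0 < a)
    (ha' : a ≤ 1 / 4) {f : Feature d → Bool} (hf : Measurable f) :
    ENNReal.ofReal (2 * a) * ∑ k ∈ T, ∫⁻ x in Ω ∩ c ⁻¹' {k},
        {x | f x ≠ decide (k ∈ A)}.indicator 1 x ∂U ≤
      ENNReal.ofReal (excessRisk (signLaw U hΩ hc T A ha.le ha') f) := by
  have hs : ∀ k, MeasurableSet (Ω ∩ c ⁻¹' {k}) := fun k =>
    hΩ.inter (hc (measurableSet_singleton k))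
  have hfm : ∀ y : Bool, MeasurableSet {x | f x ≠ y} := fun y =>
    (hf (measurableSet_singleton y)).compl
  rw [signLaw, ofReal_excessRisk_labelLaw _ _ hf]
  simp_rw [← lintegral_indicator (hs _)]
  rw [← lintegral_finsetSum _ fun k _ => (measurable_one.indicator (hfm _)).indicator (hs k),
    ← lintegral_const_mul _ (Finset.measurable_sum _ fun k _ =>
      (measurable_one.indicator (hfm _)).indicator (hs k))]
  refine lintegral_mono fun x => ?_
  by_cases hx : x ∈ Ω ∧ c x ∈ T
  · -- only the cell that contains `x` contributes
    rw [Finset.sum_eq_single (c x)]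
    · have h2 : |2 * signRegression Ω c T A a x - 1| = 2 * a := by
        by_cases hA : c x ∈ A
        · have : 2 * signRegression Ω c T A a x - 1 = 2 * a := by
            simp [signRegression, cellSign, hx.1, hx.2, hA]; ring
          rw [this, abs_of_pos (by linarith)]
        · have : 2 * signRegression Ω c T A a x - 1 = -(2 * a) := by
            simp [signRegression, cellSign, hx.1, hx.2, hA]; ring
          rw [this, abs_neg, abs_of_pos (by linarith)]
      have h3 : decide (1 / 2 < signRegression Ω c T A a x) = decide (c x ∈ A) := by
        by_cases hA : c x ∈ A <;> simp [signRegression, cellSign, hx.1, hx.2, hA, ha, ha.le]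
      rw [Set.indicator_of_mem (show x ∈ Ω ∩ c ⁻¹' {c x} from ⟨hx.1, rfl⟩)]
      by_cases hfx : f x = decide (c x ∈ A)
      · simp [Set.indicator, hfx]
      · rw [Set.indicator_of_mem (show x ∈ {y | f y ≠ decide (c x ∈ A)} from hfx),
          Set.indicator_of_mem (show x ∈ {y | f y ≠ decide (1 / 2 < signRegression Ω c T A a y)} by
            change f x ≠ _; rwa [h3]), h2]
        simp
    · intro k _ hk
      exact Set.indicator_of_notMem (fun h => hk h.2.symm) _
    · exact fun h => absurd hx.2 h
  · rw [Finset.sum_eq_zero]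
    · simp
    · intro k hk
      refine Set.indicator_of_notMem (fun h => hx ⟨h.1, ?_⟩) _
      have : c x = k := h.2
      rwa [this]

/-- The parameter of the hypercube with vertex `A`: all marginals are `U`, the target deviates from
`1/2` by `a`, the source `i` by `b i`, with common signs. -/
noncomputable def signParam {m : ℕ} (U : Measure (Feature d)) [IsProbabilityMeasure U]
    (hΩ : MeasurableSet Ω) (hc : Measurable c) (T A : Finset ι) {a : ℝ} {b : Fin m → ℝ}
    (ha : 0 ≤ a) (ha' : a ≤ 1 / 4) (hb : ∀ i, 0 ≤ b i) (hb' : ∀ i, b i ≤ 1 / 4) :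
    (Fin m → Law d) × Law d :=
  (fun i => signLaw U hΩ hc T A (hb i) (hb' i), signLaw U hΩ hc T A ha ha')

theorem chiSqBound_dataLaw {m : ℕ} {nP : Fin m → ℕ} {nQ : ℕ} (hΩ : MeasurableSet Ω)
    (hc : Measurable c) {a : ℝ} {b : Fin m → ℝ} (ha : 0 ≤ a) (ha' : a ≤ 1 / 4)
    (hb : ∀ i, 0 ≤ b i) (hb' : ∀ i, b i ≤ 1 / 4) (k : ι) :
    ChiSqBound (dataLaw nP nQ (signParam U hΩ hc T (A ∆ {k}) ha ha' hb hb'))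
      (dataLaw nP nQ (signParam U hΩ hc T A ha ha' hb hb'))
      (ENNReal.ofReal (Real.exp
        (32 * U.real (Ω ∩ c ⁻¹' {k}) * (∑ i, nP i * b i ^ 2 + nQ * a ^ 2)))) := by
  set w := U.real (Ω ∩ c ⁻¹' {k}) with hw
  have hone : ∀ {t : ℝ} (n : ℕ), ∏ _j : Fin n, ENNReal.ofReal (1 + 32 * t ^ 2 * w) ≤
      ENNReal.ofReal (Real.exp (32 * w * (n * t ^ 2))) := by
    intro t n
    have h0 : 0 ≤ w := measureReal_nonneg
    rw [Finset.prod_const, Finset.card_univ, Fintype.card_fin,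
      ← ENNReal.ofReal_pow (by positivity)]
    apply ENNReal.ofReal_le_ofReal
    calc (1 + 32 * t ^ 2 * w) ^ n ≤ Real.exp (32 * t ^ 2 * w) ^ n := by
          gcongr; linarith [Real.add_one_le_exp (32 * t ^ 2 * w)]
      _ = Real.exp (32 * w * (n * t ^ 2)) := by rw [← Real.exp_nat_mul]; ring_nf
  refine ((ChiSqBound.pi fun i => ChiSqBound.pi fun _ : Fin (nP i) =>
    chiSqBound_signLaw hΩ hc (hb i) (hb' i) k).prod
      (ChiSqBound.pi fun _ : Fin nQ => chiSqBound_signLaw hΩ hc ha ha' k)).mono ?_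
  rw [mul_add, Real.exp_add, ENNReal.ofReal_mul (Real.exp_nonneg _), Finset.mul_sum, Real.exp_sum,
    ENNReal.ofReal_prod_of_nonneg fun _ _ => Real.exp_nonneg _]
  exact mul_le_mul' (Finset.prod_le_prod' fun i _ => hone (nP i)) (hone nQ)

/-- The minimax lower bound from a hypercube of parameters. -/
theorem le_minimaxRisk_of_hypercube {m : ℕ} {nP : Fin m → ℕ} {nQ : ℕ} (hΩ : MeasurableSet Ω)
    (hc : Measurable c) {a : ℝ} {b : Fin m → ℝ} (ha : 0 < a) (ha' : a ≤ 1 / 4)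
    (hb : ∀ i, 0 ≤ b i) (hb' : ∀ i, b i ≤ 1 / 4) {w L : ℝ}
    (hw : ∀ k ∈ T, U.real (Ω ∩ c ⁻¹' {k}) = w)
    (hL0 : 0 ≤ L) (hL : 32 * w * (∑ i, nP i * b i ^ 2 + nQ * a ^ 2) ≤ L)
    {S : Set ((Fin m → Law d) × Law d)}
    (hS : ∀ A ∈ T.powerset, signParam U hΩ hc T A ha.le ha' hb hb' ∈ S) :
    ENNReal.ofReal (T.card * a * w / (4 * Real.exp L)) ≤ minimaxRisk nP nQ S := by
  refine le_iInf fun f => ?_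
  set V := ⨆ θ ∈ S, expectedExcessRisk f θ
  rcases T.eq_empty_or_nonempty with rfl | ⟨k₀, hk₀⟩
  · simp
  have hw0 : 0 ≤ w := hw k₀ hk₀ ▸ measureReal_nonneg
  let D : Finset ι → Measure (Data d m nP nQ) := fun A =>
    dataLaw nP nQ (signParam U hΩ hc T A ha.le ha' hb hb')
  have hDp : ∀ A, IsProbabilityMeasure (D A) := fun A => by
    simp only [D, dataLaw]; infer_instance
  have h1 := assouad (D := D) (U := U) (s := fun k => Ω ∩ c ⁻¹' {k}) (M := Real.exp L)
    (w := ENNReal.ofReal w) (T := T) (Real.one_le_exp hL0)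
    (fun A _ k hk => (chiSqBound_dataLaw hΩ hc ha.le ha' hb hb' k).mono (by
      rw [hw k hk]
      exact ENNReal.ofReal_le_ofReal (Real.exp_le_exp.2 hL)))
    (fun k hk => by rw [← hw k hk, ofReal_measureReal]) f.2
  have h2 : ∀ A ∈ T.powerset, ENNReal.ofReal (2 * a) * ∑ k ∈ T, ∫⁻ z, ∫⁻ x in Ω ∩ c ⁻¹' {k},
      {x | f.1 z x ≠ decide (k ∈ A)}.indicator 1 x ∂U ∂(D A) ≤ V := by
    intro A hA
    have hm : ∀ k, Measurable fun z => ∫⁻ x in Ω ∩ c ⁻¹' {k},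
        {x | f.1 z x ≠ decide (k ∈ A)}.indicator (1 : Feature d → ℝ≥0∞) x ∂U := fun k => by
      have : Measurable ({p : Data d m nP nQ × Feature d |
          f.1 p.1 p.2 ≠ decide (k ∈ A)}.indicator (1 : Data d m nP nQ × Feature d → ℝ≥0∞)) :=
        measurable_one.indicator (f.2 (measurableSet_singleton _)).compl
      exact this.lintegral_prod_right'
    rw [← lintegral_finsetSum _ fun k _ => hm k,
      ← lintegral_const_mul _ (Finset.measurable_sum _ fun k _ => hm k)]
    refine (lintegral_mono fun z => ?_).trans
      (le_iSup₂ (f := fun θ (_ : θ ∈ S) => expectedExcessRisk f θ) _ (hS A hA))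
    exact sum_le_excessRisk_signLaw hΩ hc ha ha' (f.2.comp measurable_prodMk_left)
  have h3 : 2 ^ T.card * ENNReal.ofReal (T.card * a * w / (4 * Real.exp L)) ≤ 2 ^ T.card * V := by
    calc 2 ^ T.card * ENNReal.ofReal (T.card * a * w / (4 * Real.exp L))
        = ENNReal.ofReal a * (2 ^ T.card *
            (T.card * (ENNReal.ofReal (1 / (4 * Real.exp L)) * ENNReal.ofReal w))) := by
          rw [mul_left_comm (ENNReal.ofReal a), ← ENNReal.ofReal_natCast T.card,
            ← ENNReal.ofReal_mul (by positivity), ← ENNReal.ofReal_mul (by positivity),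
            ← ENNReal.ofReal_mul ha.le]
          congr 2
          ring
      _ ≤ ENNReal.ofReal a * (2 * ∑ A ∈ T.powerset, ∑ k ∈ T, ∫⁻ z, ∫⁻ x in Ω ∩ c ⁻¹' {k},
            {x | f.1 z x ≠ decide (k ∈ A)}.indicator 1 x ∂U ∂(D A)) := by gcongr
      _ = ∑ A ∈ T.powerset, ENNReal.ofReal (2 * a) * ∑ k ∈ T, ∫⁻ z, ∫⁻ x in Ω ∩ c ⁻¹' {k},
            {x | f.1 z x ≠ decide (k ∈ A)}.indicator 1 x ∂U ∂(D A) := by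
          rw [← Finset.mul_sum, ENNReal.ofReal_mul zero_le_two, ENNReal.ofReal_ofNat]
          ring
      _ ≤ ∑ _A ∈ T.powerset, V := Finset.sum_le_sum h2
      _ = 2 ^ T.card * V := by
          rw [Finset.sum_const, Finset.card_powerset, nsmul_eq_mul]; norm_cast
  exact (ENNReal.mul_le_mul_iff_right (by simp) (by simp)).1 h3

end Hypercube

/-! ### A comb-shaped set and its regularity -/

/-- On one of the two sides of `x`, or over its whole length, the interval `[p, q]` has room
for a length `s`. -/
theorem ofReal_le_volume_inter_Ioo {p q x s : ℝ} (hx : x ∈ Set.Icc p q) (hs : s ≤ q - p) :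
    ENNReal.ofReal s ≤ volume (Set.Ico p q ∩ Set.Ioo (x - s) (x + s)) := by
  rcases le_or_gt s 0 with h0 | h0
  · simp [ENNReal.ofReal_of_nonpos h0]
  calc ENNReal.ofReal s ≤ ENNReal.ofReal (min q (x + s) - max p (x - s)) := by
        apply ENNReal.ofReal_le_ofReal
        rcases min_cases q (x + s) with h | h <;> rcases max_cases p (x - s) with h' | h' <;>
          linarith [hx.1, hx.2, h.1, h'.1]
    _ = volume (Set.Ioo (max p (x - s)) (min q (x + s))) := Real.volume_Ioo.symm
    _ ≤ _ := measure_mono fun t ht => by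
        obtain ⟨h1, h2⟩ := ht
        exact ⟨⟨(le_max_left _ _).trans h1.le, h2.trans_le (min_le_left _ _)⟩,
          (le_max_right _ _).trans_lt h1, h2.trans_le (min_le_right _ _)⟩

/-- The interval `[0, N h]` cut into `N` pieces of length `h`, with the last fraction `ε` of each
piece removed. -/
def comb (ε h : ℝ) (N : ℕ) : Set ℝ := ⋃ k : Fin N, Set.Icc (k * h) (k * h + (1 - ε) * h)

section Comb

variable {ε h : ℝ} {N : ℕ}

theorem mem_comb {t : ℝ} :
    t ∈ comb ε h N ↔ ∃ k : Fin N, k * h ≤ t ∧ t ≤ k * h + (1 - ε) * h := by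
  simp [comb]

theorem isClosed_comb : IsClosed (comb ε h N) := isClosed_iUnion_of_finite fun _ => isClosed_Icc

theorem comb_subset (hε : 0 ≤ ε) (hh : 0 < h) : comb ε h N ⊆ Set.Icc 0 (N * h) := by
  intro t ht
  obtain ⟨k, h1, h2⟩ := mem_comb.1 ht
  have hk : (k : ℝ) + 1 ≤ N := by exact_mod_cast k.2
  have hk0 : (0 : ℝ) ≤ (k : ℕ) := Nat.cast_nonneg _
  exact ⟨by nlinarith, by nlinarith⟩

theorem floor_div_eq (hε : 0 < ε) (hh : 0 < h) {k : ℤ} {t : ℝ} (h1 : k * h ≤ t)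
    (h2 : t ≤ k * h + (1 - ε) * h) : ⌊t / h⌋ = k := by
  rw [Int.floor_eq_iff, le_div_iff₀ hh, div_lt_iff₀ hh]
  exact ⟨h1, by nlinarith⟩

theorem mem_comb_iff_floor (hε : 0 < ε) (hh : 0 < h) {t : ℝ} :
    t ∈ comb ε h N ↔ 0 ≤ ⌊t / h⌋ ∧ ⌊t / h⌋ < N ∧ t ≤ ⌊t / h⌋ * h + (1 - ε) * h := by
  rw [mem_comb]
  constructor
  · rintro ⟨k, h1, h2⟩
    have := floor_div_eq (k := (k : ℕ)) hε hh (by exact_mod_cast h1) (by exact_mod_cast h2)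
    rw [this]
    exact ⟨by positivity, by exact_mod_cast k.2, by exact_mod_cast h2⟩
  · rintro ⟨h1, h2, h3⟩
    lift ⌊t / h⌋ to ℕ using h1 with n hn
    refine ⟨⟨n, by exact_mod_cast h2⟩, ?_, by exact_mod_cast h3⟩
    have := Int.floor_le (t / h)
    rw [← hn, le_div_iff₀ hh] at this
    exact_mod_cast this

/-- Points of the comb in different pieces are at distance at least `ε h`. -/
theorem le_abs_sub_of_floor_ne (hε : 0 < ε) (hh : 0 < h) {t u : ℝ} (ht : t ∈ comb ε h N)
    (hu : u ∈ comb ε h N) (hne : ⌊t / h⌋ ≠ ⌊u / h⌋) : ε * h ≤ |t - u| := by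
  wlog hlt : ⌊t / h⌋ < ⌊u / h⌋ generalizing t u
  · rw [abs_sub_comm]
    exact this hu ht hne.symm (lt_of_le_of_ne (not_lt.1 hlt) hne.symm)
  have h1 := ((mem_comb_iff_floor hε hh).1 ht).2.2
  have h2 := Int.floor_le (u / h)
  rw [le_div_iff₀ hh] at h2
  have h3 : (⌊t / h⌋ : ℝ) + 1 ≤ ⌊u / h⌋ := by exact_mod_cast hlt
  rw [abs_sub_comm]
  refine le_trans ?_ (le_abs_self _)
  nlinarith

theorem volume_comb (hε : 0 < ε) (hh : 0 < h) :
    volume (comb ε h N) = ENNReal.ofReal ((1 - ε) * (N * h)) := by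
  rw [comb, measure_iUnion _ fun _ => measurableSet_Icc]
  · simp only [Real.volume_Icc, add_sub_cancel_left, tsum_fintype, Finset.sum_const,
      Finset.card_univ, Fintype.card_fin, nsmul_eq_mul]
    rw [← ENNReal.ofReal_natCast, ← ENNReal.ofReal_mul (Nat.cast_nonneg _)]
    ring_nf
  · intro i j hij
    refine Set.disjoint_left.2 fun t hi hj => hij ?_
    have h1 := floor_div_eq (k := (i : ℕ)) hε hh (by exact_mod_cast hi.1) (by exact_mod_cast hi.2)
    have h2 := floor_div_eq (k := (j : ℕ)) hε hh (by exact_mod_cast hj.1) (by exact_mod_cast hj.2)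
    exact Fin.ext (by exact_mod_cast h1.symm.trans h2)

/-- One-dimensional regularity of the comb. An interval shorter than a tooth is treated inside the
tooth of its centre; a longer one meets at most `2 s / h + 2` gaps of length `ε h`. -/
theorem volume_comb_inter_Ioo (hε : 0 < ε) (hε1 : ε ≤ 1 / 2) (hh : 0 < h) {x s : ℝ}
    (hx : x ∈ comb ε h N) (hs : s ≤ N * h) :
    ENNReal.ofReal ((1 - 6 * ε) / 2) * volume (Set.Ioo (x - s) (x + s)) ≤
      volume (comb ε h N ∩ Set.Ioo (x - s) (x + s)) := by
  rcases le_or_gt s 0 with h0 | h0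
  · rw [Set.Ioo_eq_empty (by linarith)]; simp
  rcases lt_or_ge (1 - 6 * ε) 0 with hneg | hneg
  · rw [ENNReal.ofReal_of_nonpos (by linarith)]; simp
  have hle : ENNReal.ofReal ((1 - 6 * ε) / 2) * volume (Set.Ioo (x - s) (x + s)) =
      ENNReal.ofReal (s - 6 * ε * s) := by
    rw [Real.volume_Ioo, ← ENNReal.ofReal_mul (by linarith)]
    ring_nf
  rw [hle]
  rcases le_or_gt s ((1 - ε) * h) with hsh | hsh
  · obtain ⟨k, h1, h2⟩ := mem_comb.1 hx
    calc ENNReal.ofReal (s - 6 * ε * s) ≤ ENNReal.ofReal s :=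
          ENNReal.ofReal_le_ofReal (by nlinarith)
      _ ≤ volume (Set.Ico (k * h) (k * h + (1 - ε) * h) ∩ Set.Ioo (x - s) (x + s)) :=
          ofReal_le_volume_inter_Ioo ⟨h1, h2⟩ (by linarith)
      _ ≤ _ := measure_mono (Set.inter_subset_inter_left _ fun t ht =>
          mem_comb.2 ⟨k, ht.1, ht.2.le⟩)
  · have hh2 : h ≤ 2 * s := by nlinarith
    set I := Finset.Icc ⌊(x - s) / h⌋ ⌊(x + s) / h⌋
    have hcard : (I.card : ℝ) ≤ 2 * s / h + 2 := by
      have h1 : ⌊(x - s) / h⌋ ≤ ⌊(x + s) / h⌋ := Int.floor_le_floor (by gcongr; linarith)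
      have h2 : ((I.card : ℤ) : ℝ) = ⌊(x + s) / h⌋ + 1 - ⌊(x - s) / h⌋ := by
        rw [Int.card_Icc, Int.toNat_of_nonneg (by linarith)]; push_cast; ring
      have h3 := Int.floor_le ((x + s) / h)
      have h4 := Int.lt_floor_add_one ((x - s) / h)
      have h5 : (x + s) / h - (x - s) / h = 2 * s / h := by ring
      rw [Int.cast_natCast] at h2
      linarith
    have hgap : volume (⋃ k ∈ I, Set.Icc (k * h + (1 - ε) * h) (k * h + h)) ≤
        ENNReal.ofReal (6 * ε * s) := by
      refine (measure_biUnion_finset_le _ _).trans ?_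
      have : ∀ k : ℤ, volume (Set.Icc ((k : ℝ) * h + (1 - ε) * h) (k * h + h)) =
          ENNReal.ofReal (ε * h) := fun k => by rw [Real.volume_Icc]; ring_nf
      simp only [this, Finset.sum_const, nsmul_eq_mul]
      rw [← ENNReal.ofReal_natCast, ← ENNReal.ofReal_mul (Nat.cast_nonneg _)]
      apply ENNReal.ofReal_le_ofReal
      calc (I.card : ℝ) * (ε * h) ≤ (2 * s / h + 2) * (ε * h) := by gcongr
        _ = 2 * ε * s + 2 * ε * h := by field_simp
        _ ≤ 6 * ε * s := by nlinarith [mul_le_mul_of_nonneg_left hh2 hε.le]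
    have hsub : Set.Ico 0 (N * h) ∩ Set.Ioo (x - s) (x + s) ⊆
        (comb ε h N ∩ Set.Ioo (x - s) (x + s)) ∪
          ⋃ k ∈ I, Set.Icc (k * h + (1 - ε) * h) (k * h + h) := by
      rintro t ⟨⟨ht0, htN⟩, ht1, ht2⟩
      by_cases htc : t ∈ comb ε h N
      · exact Or.inl ⟨htc, ht1, ht2⟩
      · right
        refine Set.mem_biUnion (x := ⌊t / h⌋) ?_ ?_
        · rw [Finset.mem_coe, Finset.mem_Icc]
          exact ⟨Int.floor_le_floor (by gcongr), Int.floor_le_floor (by gcongr)⟩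
        · have h1 : 0 ≤ ⌊t / h⌋ := Int.floor_nonneg.2 (by positivity)
          have h2 : ⌊t / h⌋ < N := by
            rw [Int.floor_lt, div_lt_iff₀ hh]; exact_mod_cast htN
          have h3 : ⌊t / h⌋ * h + (1 - ε) * h < t := by
            by_contra hcon
            exact htc ((mem_comb_iff_floor hε hh).2 ⟨h1, h2, not_lt.1 hcon⟩)
          have h4 := Int.lt_floor_add_one (t / h)
          rw [div_lt_iff₀ hh] at h4
          exact ⟨h3.le, by linarith⟩
    rw [ENNReal.ofReal_sub _ (by positivity)]
    refine tsub_le_iff_right.2 ?_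
    calc ENNReal.ofReal s
        ≤ volume (Set.Ico 0 (N * h) ∩ Set.Ioo (x - s) (x + s)) :=
          ofReal_le_volume_inter_Ioo (comb_subset hε.le hh hx) (by linarith)
      _ ≤ _ := (measure_mono hsub).trans ((measure_union_le _ _).trans (by gcongr))

end Comb

/-- If every interval of half-length at most `r` around the coordinate `x j` keeps the fraction
`κ` of its length in `V`, then the ball of radius `r` around `x` keeps the fraction `κ ^ d` of its
volume in `V ^ d`: the coordinates are restricted to `V` one after the other, and at each step the fibres
in that coordinate are intervals centred at `x j`. -/
theorem volume_ball_inter_pi {d : ℕ} {V : Set ℝ} (hV : MeasurableSet V) {x : Feature d} {r : ℝ}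
    (hr : 0 < r) {κ : ℝ≥0∞}
    (hx : ∀ j, ∀ s ≤ r, κ * volume (Set.Ioo (x j - s) (x j + s)) ≤
      volume (V ∩ Set.Ioo (x j - s) (x j + s))) :
    κ ^ d * volume (Metric.ball x r) ≤ volume ({y | ∀ j, y j ∈ V} ∩ Metric.ball x r) := by
  classical
  set B : Set (Fin d → ℝ) := {y | ∑ j, (y j - x j) ^ 2 < r ^ 2} with hB
  have hBm : MeasurableSet B := by
    refine measurableSet_lt ?_ measurable_const
    fun_prop
  have hball : Metric.ball x r = (WithLp.ofLp : Feature d → Fin d → ℝ) ⁻¹' B := by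
    ext y
    rw [Metric.mem_ball, EuclideanSpace.dist_eq, Real.sqrt_lt' hr]
    simp [hB, Real.dist_eq, sq_abs]
  let A : Finset (Fin d) → Set (Fin d → ℝ) := fun T => B ∩ {y | ∀ j ∈ T, y j ∈ V}
  have hAm : ∀ T, MeasurableSet (A T) := fun T => by
    refine hBm.inter ?_
    have : {y : Fin d → ℝ | ∀ j ∈ T, y j ∈ V} = ⋂ j ∈ T, (fun y => y j) ⁻¹' V := by
      ext y; simp
    rw [this]
    exact Finset.measurableSet_biInter _ fun j _ => measurable_pi_apply j hV
  have hstep : ∀ (T : Finset (Fin d)) (i : Fin d), i ∉ T →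
      κ * volume (A T) ≤ volume (A (insert i T)) := by
    intro T i hi
    rw [← lintegral_indicator_one (hAm _), ← lintegral_indicator_one (hAm _),
      ← lintegral_const_mul _ (measurable_one.indicator (hAm _))]
    refine lintegral_le_of_lmarginal_le {i} ((measurable_one.indicator (hAm _)).const_mul _)
      (measurable_one.indicator (hAm _)) ?_
    intro y
    rw [lmarginal_singleton, lmarginal_singleton]
    have hum : Measurable (Function.update y i) := measurable_update y
    set F : Set ℝ := Function.update y i ⁻¹' A T with hF
    have hFm : MeasurableSet F := hum (hAm T)
    have hFi : Function.update y i ⁻¹' A (insert i T) = V ∩ F := by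
      ext t
      simp only [hF, A, Set.mem_preimage, Set.mem_inter_iff, Set.mem_ofPred_eq,
        Finset.forall_mem_insert, Function.update_self]
      tauto
    have hl : ∀ T', ∫⁻ t, (A T').indicator (1 : (Fin d → ℝ) → ℝ≥0∞) (Function.update y i t) =
        volume (Function.update y i ⁻¹' A T') := fun T' => by
      rw [← lintegral_indicator_one (hum (hAm T'))]
      rfl
    have him : Measurable fun t =>
        (A T).indicator (1 : (Fin d → ℝ) → ℝ≥0∞) (Function.update y i t) :=
      (measurable_one.indicator (hAm T)).comp hum
    beta_reduce
    rw [lintegral_const_mul _ him, hl, hl, hFi, ← hF]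
    set R := ∑ j ∈ Finset.univ.erase i, (y j - x j) ^ 2 with hR
    have hR0 : 0 ≤ R := Finset.sum_nonneg fun _ _ => sq_nonneg _
    have hmem : ∀ t, t ∈ F ↔ (t - x i) ^ 2 + R < r ^ 2 ∧ ∀ j ∈ T, y j ∈ V := by
      intro t
      have h1 : ∑ j, (Function.update y i t j - x j) ^ 2 = (t - x i) ^ 2 + R := by
        rw [← Finset.add_sum_erase _ _ (Finset.mem_univ i), Function.update_self]
        congr 1
        refine Finset.sum_congr rfl fun j hj => ?_
        rw [Function.update_of_ne (Finset.ne_of_mem_erase hj)]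
      have h2 : (∀ j ∈ T, Function.update y i t j ∈ V) ↔ ∀ j ∈ T, y j ∈ V := by
        refine forall₂_congr fun j hj => ?_
        rw [Function.update_of_ne (ne_of_mem_of_not_mem hj hi)]
      simp only [hF, A, hB, Set.mem_preimage, Set.mem_inter_iff, Set.mem_ofPred_eq, h1, h2]
    by_cases hc : R < r ^ 2 ∧ ∀ j ∈ T, y j ∈ V
    · have hFI : F = Set.Ioo (x i - √(r ^ 2 - R)) (x i + √(r ^ 2 - R)) := by
        ext t
        rw [hmem, Set.mem_Ioo, and_iff_left hc.2, ← lt_sub_iff_add_lt,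
          ← Real.sqrt_lt_sqrt_iff (sq_nonneg _), Real.sqrt_sq_eq_abs, abs_lt]
        constructor <;> rintro ⟨h1, h2⟩ <;> constructor <;> linarith
      rw [hFI]
      refine hx i _ ?_
      rw [Real.sqrt_le_left hr.le]
      linarith
    · have : F = ∅ := by
        ext t
        rw [hmem]
        simp only [Set.mem_empty_iff_false, iff_false]
        rintro ⟨h1, h2⟩
        exact hc ⟨by nlinarith [sq_nonneg (t - x i)], h2⟩
      simp [this]
  have hind : ∀ T : Finset (Fin d), κ ^ T.card * volume B ≤ volume (A T) := by
    intro T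
    induction T using Finset.induction_on with
    | empty => simp [A]
    | insert i T hi ih =>
      rw [Finset.card_insert_of_notMem hi, pow_succ', mul_assoc]
      exact (by gcongr : _ ≤ κ * volume (A T)).trans (hstep T i hi)
  have hmp := EuclideanSpace.volume_preserving_symm_measurableEquiv_toLp (Fin d)
  have h := hind Finset.univ
  rw [Finset.card_univ, Fintype.card_fin] at h
  have e1 : volume (Metric.ball x r) = volume B := by
    rw [hball]; exact hmp.measure_preimage hBm.nullMeasurableSet
  have e2 : volume ({y : Feature d | ∀ j, y j ∈ V} ∩ Metric.ball x r) =
      volume (A Finset.univ) := by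
    rw [← hmp.measure_preimage (hAm _).nullMeasurableSet, hball]
    congr 1
    ext y
    simp [A, and_comm]
  rwa [e1, e2]

theorem volume_setOf_forall_mem {d : ℕ} {V : Fin d → Set ℝ} (hV : ∀ j, MeasurableSet (V j)) :
    volume {y : Feature d | ∀ j, y j ∈ V j} = ∏ j, volume (V j) := by
  have hmp := EuclideanSpace.volume_preserving_symm_measurableEquiv_toLp (Fin d)
  rw [← volume_pi_pi, ← hmp.measure_preimage
    (MeasurableSet.univ_pi hV).nullMeasurableSet]
  congr 1
  ext y
  simp

/-! ### The hypercube lies in the drift class -/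

/-- The support of all marginals: the `d`-th power of the comb, a union of `N ^ d` cubes separated
by gaps of width `ε h`. -/
def combPow (d : ℕ) (ε h : ℝ) (N : ℕ) : Set (Feature d) := {x | ∀ j, x j ∈ comb ε h N}

/-- The index of the cell of side `h` that contains a point. -/
noncomputable def cellIndex {d : ℕ} (h : ℝ) (x : Feature d) : Fin d → ℤ := fun j => ⌊x j / h⌋

/-- The uniform distribution on `combPow`. -/
noncomputable def combMeasure (d : ℕ) (ε h : ℝ) (N : ℕ) : Measure (Feature d) :=
  ProbabilityTheory.cond volume (combPow d ε h N)

section CombPow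

variable {d : ℕ} {ε h : ℝ} {N : ℕ}

theorem isClosed_combPow : IsClosed (combPow d ε h N) := by
  have : combPow d ε h N = ⋂ j, (fun x : Feature d => x j) ⁻¹' comb ε h N := by
    ext x; simp [combPow]
  rw [this]
  exact isClosed_iInter fun j => isClosed_comb.preimage (by fun_prop)

theorem measurable_cellIndex : Measurable (cellIndex (d := d) h) :=
  measurable_pi_lambda _ fun j => by
    have : Measurable fun x : Feature d => x j / h := by fun_prop
    exact this.floor

theorem volume_combPow (hε : 0 < ε) (hε1 : ε < 1) (hh : 0 < h) :
    volume (combPow d ε h N) = ENNReal.ofReal (((1 - ε) * (N * h)) ^ d) := by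
  have := volume_setOf_forall_mem (d := d) (V := fun _ => comb ε h N)
    fun _ => isClosed_comb.measurableSet
  rw [combPow, this, Finset.prod_const, volume_comb hε hh, Finset.card_univ, Fintype.card_fin,
    ENNReal.ofReal_pow]
  have : 0 < 1 - ε := by linarith
  positivity

theorem isProbabilityMeasure_combMeasure (hε : 0 < ε) (hε1 : ε < 1) (hh : 0 < h) (hN : 0 < N) :
    IsProbabilityMeasure (combMeasure d ε h N) := by
  have hN' : (0 : ℝ) < N := by exact_mod_cast hN
  have h1 : 0 < 1 - ε := by linarith
  refine ProbabilityTheory.cond_isProbabilityMeasure_of_finite ?_ ?_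
  · rw [volume_combPow hε hε1 hh]
    exact (ENNReal.ofReal_pos.2 (by positivity)).ne'
  · rw [volume_combPow hε hε1 hh]
    exact ENNReal.ofReal_ne_top

theorem combMeasure_real_cell (hε : 0 < ε) (hε1 : ε < 1) (hh : 0 < h) (hN : 0 < N)
    {k : Fin d → ℤ} (hk : ∀ j, 0 ≤ k j ∧ k j < N) :
    (combMeasure d ε h N).real (combPow d ε h N ∩ cellIndex h ⁻¹' {k}) = (1 / (N : ℝ)) ^ d := by
  have hN' : (0 : ℝ) < N := by exact_mod_cast hN
  have h1 : 0 < 1 - ε := by linarith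
  have hset : combPow d ε h N ∩ cellIndex h ⁻¹' {k} =
      {x | ∀ j, x j ∈ Set.Icc (k j * h) (k j * h + (1 - ε) * h)} := by
    ext x
    constructor
    · rintro ⟨hx, hxk⟩ j
      have hj : ⌊x j / h⌋ = k j := congrFun hxk j
      have h2 := Int.floor_le (x j / h)
      rw [hj, le_div_iff₀ hh] at h2
      have h3 := ((mem_comb_iff_floor hε hh).1 (hx j)).2.2
      rw [hj] at h3
      exact ⟨h2, h3⟩
    · intro hx
      have hj : ∀ j, ⌊x j / h⌋ = k j := fun j => floor_div_eq hε hh (hx j).1 (hx j).2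
      refine ⟨fun j => (mem_comb_iff_floor hε hh).2 ?_, funext hj⟩
      rw [hj]
      exact ⟨(hk j).1, (hk j).2, (hx j).2⟩
  have hvol : volume (combPow d ε h N ∩ cellIndex h ⁻¹' {k}) =
      ENNReal.ofReal (((1 - ε) * h) ^ d) := by
    rw [hset, volume_setOf_forall_mem fun _ => measurableSet_Icc]
    simp only [Real.volume_Icc, add_sub_cancel_left, Finset.prod_const, Finset.card_univ,
      Fintype.card_fin]
    rw [ENNReal.ofReal_pow (by positivity)]
  rw [combMeasure, Measure.real, ProbabilityTheory.cond_apply isClosed_combPow.measurableSet,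
    ← Set.inter_assoc, Set.inter_self, hvol, volume_combPow hε hε1 hh, ENNReal.toReal_mul,
    ENNReal.toReal_inv, ENNReal.toReal_ofReal (by positivity),
    ENNReal.toReal_ofReal (by positivity)]
  have : (1 - ε) * h = (1 - ε) * (N * h) * (1 / N) := by field_simp
  rw [this, mul_pow _ (1 / (N : ℝ)), ← mul_assoc, inv_mul_cancel₀ (by positivity), one_mul]

theorem volume_combPow_inter_ball (hε : 0 < ε) (hε1 : ε ≤ 1 / 2) (hh : 0 < h) {x : Feature d}
    (hx : x ∈ combPow d ε h N) {r : ℝ} (hr : 0 < r) (hrN : r ≤ N * h) :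
    ENNReal.ofReal ((1 - 6 * ε) / 2) ^ d * volume (Metric.ball x r) ≤
      volume (combPow d ε h N ∩ Metric.ball x r) :=
  volume_ball_inter_pi isClosed_comb.measurableSet hr fun j _ hs =>
    volume_comb_inter_Ioo hε hε1 hh (hx j) (hs.trans hrN)

/-- Regularity of `combPow` at all scales up to `rμ`; beyond the side `N h` of the cube the ball
only grows, which costs the factor `(rμ / (N h)) ^ d`. -/
theorem regular_combPow (hε : 0 < ε) (hε1 : ε ≤ 1 / 6) (hh : 0 < h) (hN : 0 < N) {cμ rμ : ℝ}
    (hcμ : 0 ≤ cμ) (hreg : cμ * max 1 (rμ / (N * h)) ^ d ≤ ((1 - 6 * ε) / 2) ^ d) {x : Feature d}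
    (hx : x ∈ combPow d ε h N) {r : ℝ} (hr : 0 < r) (hrμ : r ≤ rμ) :
    ENNReal.ofReal cμ * volume (Metric.ball x r) ≤ volume (combPow d ε h N ∩ Metric.ball x r) := by
  have hN' : (0 : ℝ) < N := by exact_mod_cast hN
  have h0 : 0 < N * h := by positivity
  have h6 : 0 ≤ (1 - 6 * ε) / 2 := by linarith
  set M := max 1 (rμ / (N * h))
  have hM : 1 ≤ M := le_max_left _ _
  set r' := min r (N * h)
  have hr' : 0 < r' := lt_min hr h0
  have hrr : r ≤ M * r' := by
    rcases min_cases r (N * h) with ⟨e, _⟩ | ⟨e, _⟩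
    · rw [show r' = r from e]; nlinarith
    · rw [show r' = N * h from e]
      calc r ≤ rμ := hrμ
        _ = rμ / (N * h) * (N * h) := by field_simp
        _ ≤ M * (N * h) := by gcongr; exact le_max_right _ _
  calc ENNReal.ofReal cμ * volume (Metric.ball x r)
      ≤ ENNReal.ofReal cμ * volume (Metric.ball x (M * r')) := by
        gcongr
    _ = ENNReal.ofReal (cμ * M ^ d) * volume (Metric.ball x r') := by
        rw [Measure.addHaar_ball_mul_of_pos _ _ (by linarith), finrank_euclideanSpace_fin,
          ENNReal.ofReal_mul hcμ, mul_assoc]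
        congr 2
        simp [Measure.addHaar_ball_center]
    _ ≤ ENNReal.ofReal ((1 - 6 * ε) / 2) ^ d * volume (Metric.ball x r') := by
        rw [← ENNReal.ofReal_pow h6]
        gcongr
    _ ≤ volume (combPow d ε h N ∩ Metric.ball x r') :=
        volume_combPow_inter_ball hε (by linarith) hh hx hr' (min_le_right _ _)
    _ ≤ _ := by
        gcongr
        exact min_le_left _ _

theorem combMeasure_eq : combMeasure d ε h N =
    (volume (combPow d ε h N))⁻¹ • volume.restrict (combPow d ε h N) := rfl

theorem support_combMeasure (hε : 0 < ε) (hε1 : ε < 1 / 6) (hh : 0 < h) (hN : 0 < N) :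
    (combMeasure d ε h N).support = combPow d ε h N := by
  have hN' : (0 : ℝ) < N := by exact_mod_cast hN
  have := isProbabilityMeasure_combMeasure (d := d) hε (by linarith) hh hN
  refine Set.Subset.antisymm ?_ fun x hx => ?_
  · refine Measure.support_subset_of_isClosed isClosed_combPow ?_
    exact ProbabilityTheory.ae_cond_mem isClosed_combPow.measurableSet
  · rw [Measure.mem_support_iff_forall]
    intro V hV
    obtain ⟨r, hr, hrV⟩ := Metric.mem_nhds_iff.1 hV
    set r' := min r (N * h)
    have hr' : 0 < r' := lt_min hr (by positivity)
    have h1 := volume_combPow_inter_ball hε (by linarith) hh hx hr' (min_le_right _ _)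
    have h2 : 0 < volume (combPow d ε h N ∩ Metric.ball x r') := by
      refine lt_of_lt_of_le ?_ h1
      refine ENNReal.mul_pos (pow_ne_zero _ (ENNReal.ofReal_pos.2 (by linarith)).ne') ?_
      exact (Metric.measure_ball_pos _ _ hr').ne'
    have h3 : volume (combPow d ε h N) ≠ ⊤ := by
      rw [volume_combPow hε (by linarith) hh]; exact ENNReal.ofReal_ne_top
    rw [combMeasure]
    have h4 : Metric.ball x r' ⊆ V := (Metric.ball_subset_ball (min_le_left _ _)).trans hrV
    refine lt_of_lt_of_le ?_ (measure_mono h4)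
    rw [ProbabilityTheory.cond_apply isClosed_combPow.measurableSet]
    exact ENNReal.mul_pos (ENNReal.inv_ne_zero.2 h3) h2.ne'

theorem rnDeriv_combMeasure (hε : 0 < ε) (hε1 : ε < 1) (hh : 0 < h) (hN : 0 < N) :
    ∀ᵐ x ∂(volume.restrict (combPow d ε h N)),
      (combMeasure d ε h N).rnDeriv volume x =
        ENNReal.ofReal (((1 - ε) * (N * h)) ^ d)⁻¹ := by
  have hN' : (0 : ℝ) < N := by exact_mod_cast hN
  have h1 : 0 < 1 - ε := by linarith
  have h2 : (volume (combPow d ε h N))⁻¹ =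
      ENNReal.ofReal (((1 - ε) * (N * h)) ^ d)⁻¹ := by
    rw [volume_combPow hε hε1 hh, ENNReal.ofReal_inv_of_pos (by positivity)]
  rw [ae_restrict_iff' isClosed_combPow.measurableSet, combMeasure_eq, h2]
  filter_upwards [Measure.rnDeriv_smul_left_of_ne_top' (volume.restrict (combPow d ε h N)) volume
    (ENNReal.ofReal_ne_top (r := (((1 - ε) * (N * h)) ^ d)⁻¹)),
    Measure.rnDeriv_restrict_self volume (isClosed_combPow (d := d) (ε := ε) (h := h)
      (N := N)).measurableSet] with x hx1 hx2 hx
  rw [hx1, Pi.smul_apply, hx2]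
  simp [hx]

end CombPow

/-- Membership of the hypercube in the drift class. The regression functions are constant on each
cube of `combPow`, so the Hölder condition only concerns points at distance at least `ε h`, and the
margin condition only levels `t > a`. -/
theorem signParam_mem_driftClass {d m : ℕ} {α Cα β Cβ μm μp cμ rμ ℓ ε h a : ℝ} {γ Cγ b : Fin m → ℝ}
    {N : ℕ} {T A : Finset (Fin d → ℤ)}
    (hα : 0 ≤ α) (hβ : 0 < β) (hCβ : 0 < Cβ) (hCα : 0 < Cα) (hcμ : 0 < cμ) (hℓ : 0 < ℓ)
    (hℓ1 : ℓ ≤ 1) (hμm : 0 < μm) (hμmℓ : μm * ℓ ^ d < 1) (hε : 0 < ε) (hε1 : ε < 1 / 6)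
    (hμpℓ : 1 < μp * ((1 - ε) * ℓ) ^ d)
    (hreg : cμ * max 1 (rμ / ℓ) ^ d ≤ ((1 - 6 * ε) / 2) ^ d) (hN : 0 < N)
    (hh : 0 < h) (hNh : N * h = ℓ) (hγ : ∀ i, 0 < γ i)
    (hT : ∀ k ∈ T, ∀ j, 0 ≤ k j ∧ k j < N) (ha : 0 < a) (ha' : a ≤ 1 / 4)
    (haβ : 2 * a ≤ Cβ * (ε * h) ^ β) (haα : T.card * (1 / (N : ℝ)) ^ d ≤ Cα * a ^ α)
    (hb : ∀ i, 0 ≤ b i) (hb' : ∀ i, b i ≤ 1 / 4) (hbγ : ∀ i, b i = Cγ i * a ^ γ i)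
    [IsProbabilityMeasure (combMeasure d ε h N)] :
    signParam (combMeasure d ε h N)
        (isClosed_combPow (d := d) (ε := ε) (h := h) (N := N)).measurableSet
        (measurable_cellIndex (h := h)) T A ha.le ha' hb hb' ∈
      driftClass d m α Cα β Cβ γ Cγ μm μp cμ rμ := by
  have hN' : (0 : ℝ) < N := by exact_mod_cast hN
  have hsupp := support_combMeasure (d := d) hε hε1 hh hN
  set Ω := combPow d ε h N with hΩ
  have hΩm : MeasurableSet Ω := isClosed_combPow.measurableSet
  have hmarg : ∀ {t : ℝ} (ht : 0 ≤ t) (ht' : t ≤ 1 / 4), marginal (signLaw (combMeasure d ε h N) hΩm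
      (measurable_cellIndex (h := h)) T A ht ht') = combMeasure d ε h N :=
    fun _ _ => marginal_labelLaw _ _
  have hsuppl : ∀ {t : ℝ} (ht : 0 ≤ t) (ht' : t ≤ 1 / 4), supp (signLaw (combMeasure d ε h N) hΩm
      (measurable_cellIndex (h := h)) T A ht ht') = Ω := fun _ _ => by
    rw [supp, hmarg, hsupp]
  have hcube : ∀ᵐ x ∂combMeasure d ε h N, ∀ j, 0 ≤ x j ∧ x j ≤ 1 := by
    have : ∀ᵐ x ∂combMeasure d ε h N, x ∈ Ω := ProbabilityTheory.ae_cond_mem hΩm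
    filter_upwards [this] with x hx j
    have := comb_subset hε.le hh (hx j)
    rw [hNh] at this
    exact ⟨this.1, this.2.trans hℓ1⟩
  have hdens : combMeasure d ε h N ≪ volume ∧ ∀ᵐ x ∂(volume.restrict Ω),
      ENNReal.ofReal μm < (combMeasure d ε h N).rnDeriv volume x ∧
        (combMeasure d ε h N).rnDeriv volume x < ENNReal.ofReal μp := by
    refine ⟨ProbabilityTheory.cond_absolutelyContinuous, ?_⟩
    filter_upwards [rnDeriv_combMeasure (d := d) hε (by linarith) hh hN] with x hx
    have hv : 0 < ((1 - ε) * ℓ) ^ d := by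
      have : 0 < 1 - ε := by linarith
      positivity
    rw [hx, hNh]
    constructor
    · rw [ENNReal.ofReal_lt_ofReal_iff (by positivity), ← one_div, lt_div_iff₀ hv]
      refine lt_of_le_of_lt ?_ hμmℓ
      gcongr
      · nlinarith
      · nlinarith
    · have hμp : 0 < μp := by
        by_contra hcon
        nlinarith
      rwa [ENNReal.ofReal_lt_ofReal_iff hμp, ← one_div, div_lt_iff₀ hv]
  have hoff : ∀ {t : ℝ} (x), x ∉ (combMeasure d ε h N).support →
      signRegression Ω (cellIndex h) T A t x = 1 / 2 := by
    intro t x hx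
    rw [hsupp] at hx
    simp [signRegression, cellSign, hx]
  have hisreg : ∀ {t : ℝ} (ht : 0 ≤ t) (ht' : t ≤ 1 / 4), IsRegression
      (signLaw (combMeasure d ε h N) hΩm (measurable_cellIndex (h := h)) T A ht ht')
      (signRegression Ω (cellIndex h) T A t) := fun _ _ => isRegression_labelLaw _ _ hoff
  refine ⟨?_, fun i => ?_, fun i => ⟨?_, ?_, ?_, ?_⟩,
    fun i => signRegression Ω (cellIndex h) T A (b i), signRegression Ω (cellIndex h) T A a,
    fun i => ?_, ?_, fun i => ?_, ?_, ?_⟩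
  · change ∀ᵐ x ∂(marginal _), _
    rwa [signParam, hmarg]
  · change ∀ᵐ x ∂(marginal _), _
    rwa [signParam, hmarg]
  · simp only [signParam, hsuppl]
  · simp only [signParam, hsuppl]
    intro x hx r hr hrr
    exact regular_combPow hε hε1.le hh hN hcμ.le (by rwa [hNh]) hx hr hrr
  · simp only [signParam, DensityBounds, hsuppl, hmarg]
    exact hdens
  · simp only [signParam, DensityBounds, hsuppl, hmarg]
    exact hdens
  · exact hisreg (hb i) (hb' i)
  · exact hisreg ha.le ha'
  · intro x _
    simp only [signRegression_sub]
    set τ := cellSign Ω (cellIndex h) T A x with hτ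
    have hbi := hb i
    refine ⟨?_, ?_⟩
    · have : b i * τ * (a * τ) = b i * a * τ ^ 2 := by ring
      rw [this]
      positivity
    · rcases cellSign_cases (Ω := Ω) (c := cellIndex h) (T := T) (A := A) x with
        ⟨-, -, h1 | h1⟩ | h1 <;> rw [hτ, h1]
      · simp [abs_of_pos ha, abs_of_nonneg hbi, ← hbγ i]
      · simp [abs_of_pos ha, abs_of_nonneg hbi, ← hbγ i]
      · simp [Real.zero_rpow (hγ i).ne']
  · intro t ht
    simp only [signParam, hmarg, signRegression_sub]
    rcases le_or_gt t a with hta | hta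
    · have : {x : Feature d | 0 < |a * cellSign Ω (cellIndex h) T A x| ∧
          |a * cellSign Ω (cellIndex h) T A x| < t} = ∅ := by
        ext x
        simp only [Set.mem_ofPred_eq, Set.mem_empty_iff_false, iff_false, not_and, not_lt]
        intro hx
        rcases cellSign_cases (Ω := Ω) (c := cellIndex h) (T := T) (A := A) x with
          ⟨-, -, h1 | h1⟩ | h1
        · rw [h1]; simpa [abs_of_pos ha] using hta
        · rw [h1]; simpa [abs_of_pos ha] using hta
        · simp [h1] at hx
      rw [this, measureReal_empty]
      positivity
    · calc (combMeasure d ε h N).real {x | 0 < |a * cellSign Ω (cellIndex h) T A x| ∧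
            |a * cellSign Ω (cellIndex h) T A x| < t}
          ≤ (combMeasure d ε h N).real (⋃ k ∈ T, Ω ∩ cellIndex h ⁻¹' {k}) := by
            refine measureReal_mono ?_ (measure_ne_top _ _)
            intro x hx
            rcases cellSign_cases (Ω := Ω) (c := cellIndex h) (T := T) (A := A) x with
              ⟨h1, h2, -⟩ | h1
            · exact Set.mem_biUnion h2 ⟨h1, rfl⟩
            · have := hx.1
              simp [h1] at this
        _ ≤ ∑ k ∈ T, (combMeasure d ε h N).real (Ω ∩ cellIndex h ⁻¹' {k}) :=
          measureReal_biUnion_finset_le _ _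
        _ = T.card * (1 / (N : ℝ)) ^ d := by
            rw [Finset.sum_congr rfl fun k hk =>
              combMeasure_real_cell hε (by linarith) hh hN (hT k hk), Finset.sum_const,
              nsmul_eq_mul]
        _ ≤ Cα * a ^ α := haα
        _ ≤ Cα * t ^ α := by gcongr
  · intro x hx y hy
    have hx' : x ∈ Ω := by simpa only [signParam, hsuppl] using hx
    have hy' : y ∈ Ω := by simpa only [signParam, hsuppl] using hy
    by_cases hxy : cellIndex h x = cellIndex h y
    · have : signRegression Ω (cellIndex h) T A a x = signRegression Ω (cellIndex h) T A a y := by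
        simp [signRegression, cellSign, hx', hy', hxy]
      rw [this, sub_self, abs_zero]
      positivity
    · obtain ⟨j, hj⟩ := Function.ne_iff.1 hxy
      have h1 := le_abs_sub_of_floor_ne hε hh (hx' j) (hy' j) hj
      have h2 : |x j - y j| ≤ ‖x - y‖ := by
        have := PiLp.norm_apply_le (x - y) j
        simpa using this
      have h3 := abs_signRegression_sub_le (Ω := Ω) (c := cellIndex h) (T := T) (A := A) ha.le x
      have h4 := abs_signRegression_sub_le (Ω := Ω) (c := cellIndex h) (T := T) (A := A) ha.le y
      calc |signRegression Ω (cellIndex h) T A a x - signRegression Ω (cellIndex h) T A a y|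
          ≤ 2 * a := by
            rw [abs_le] at h3 h4 ⊢
            constructor <;> linarith [h3.1, h3.2, h4.1, h4.2]
        _ ≤ Cβ * (ε * h) ^ β := haβ
        _ ≤ Cβ * ‖x - y‖ ^ β := by
            gcongr
            exact h1.trans h2

/-! ### Choice of the constants and of the grid size -/

open Filter Topology in
/-- The room to spare in the strong density condition leaves space for gaps. -/
theorem exists_gap_ratio (d : ℕ) {cμ μp rμ ℓ : ℝ} (hμpℓ : 1 < μp * ℓ ^ d)
    (hreg : cμ * max 1 (rμ / ℓ) ^ d < (1 / 2) ^ d) :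
    ∃ ε : ℝ, 0 < ε ∧ ε < 1 / 6 ∧ 1 < μp * ((1 - ε) * ℓ) ^ d ∧
      cμ * max 1 (rμ / ℓ) ^ d ≤ ((1 - 6 * ε) / 2) ^ d := by
  have h1 : ∀ᶠ ε : ℝ in 𝓝[>] 0, 1 < μp * ((1 - ε) * ℓ) ^ d := by
    have hc : ContinuousAt (fun ε : ℝ => μp * ((1 - ε) * ℓ) ^ d) 0 := by fun_prop
    exact nhdsWithin_le_nhds (hc.eventually_const_lt (by simpa using hμpℓ))
  have h2 : ∀ᶠ ε : ℝ in 𝓝[>] 0, cμ * max 1 (rμ / ℓ) ^ d < ((1 - 6 * ε) / 2) ^ d := by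
    have hc : ContinuousAt (fun ε : ℝ => ((1 - 6 * ε) / 2) ^ d) 0 := by fun_prop
    exact nhdsWithin_le_nhds (hc.eventually_const_lt (by simpa using hreg))
  have h3 : ∀ᶠ ε : ℝ in 𝓝[>] 0, ε < 1 / 6 :=
    nhdsWithin_le_nhds (eventually_lt_nhds (by norm_num))
  obtain ⟨ε, ⟨⟨h1, h2⟩, h3⟩, h4⟩ := (((h1.and h2).and h3).and self_mem_nhdsWithin).exists
  exact ⟨ε, h4, h3, h1, h2.le⟩

theorem one_le_effectiveSize {d m : ℕ} {β : ℝ} {γ : Fin m → ℝ} (hβ : 0 < β) (hγ : ∀ i, 0 < γ i)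
    {nP : Fin m → ℕ} {nQ : ℕ} (hn : 0 < nQ + ∑ i, nP i) : 1 ≤ effectiveSize d β γ nP nQ := by
  have hnn : ∀ i, 0 ≤ (nP i : ℝ) ^ ((2 * β + d) / (2 * γ i * β + d)) := fun i => by positivity
  rw [effectiveSize]
  rcases Nat.eq_zero_or_pos nQ with h0 | h0
  · obtain ⟨i, -, hi⟩ : ∃ i ∈ Finset.univ, nP i ≠ 0 := by
      by_contra! hcon
      rw [h0, Finset.sum_eq_zero hcon] at hn
      exact absurd hn (by simp)
    have h1 : (1 : ℝ) ≤ nP i := by exact_mod_cast Nat.one_le_iff_ne_zero.2 hi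
    have h2 : 1 ≤ (nP i : ℝ) ^ ((2 * β + d) / (2 * γ i * β + d)) := by
      have := hγ i
      exact Real.one_le_rpow h1 (by positivity)
    have h3 := Finset.single_le_sum (fun i _ => hnn i) (Finset.mem_univ i)
    have h4 : (0 : ℝ) ≤ nQ := Nat.cast_nonneg _
    linarith
  · have h1 : (1 : ℝ) ≤ nQ := by exact_mod_cast h0
    have h2 := Finset.sum_nonneg fun i (_ : i ∈ Finset.univ) => hnn i
    linarith

theorem nQ_le_effectiveSize {d m : ℕ} {β : ℝ} {γ : Fin m → ℝ} (nP : Fin m → ℕ) (nQ : ℕ) :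
    (nQ : ℝ) ≤ effectiveSize d β γ nP nQ := by
  rw [effectiveSize]
  have h2 : 0 ≤ ∑ i, (nP i : ℝ) ^ ((2 * β + d) / (2 * γ i * β + d)) :=
    Finset.sum_nonneg fun i _ => by positivity
  linarith

/-- If the effective size is at most `t ^ (2 β + d)`, the source `i` has at most
`t ^ (2 γ_i β + d)` observations: this is what the exponents in the effective size are made for. -/
theorem nP_le_rpow_of_effectiveSize_le {d m : ℕ} {β t : ℝ} {γ : Fin m → ℝ} (hβ : 0 < β)
    (hγ : ∀ i, 0 < γ i) {nP : Fin m → ℕ} {nQ : ℕ} (ht : 0 ≤ t)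
    (h : effectiveSize d β γ nP nQ ≤ t ^ (2 * β + d)) (i : Fin m) :
    (nP i : ℝ) ≤ t ^ (2 * γ i * β + d) := by
  have hγi := hγ i
  have h1 : (nP i : ℝ) ^ ((2 * β + d) / (2 * γ i * β + d)) ≤ t ^ (2 * β + d) := by
    refine le_trans ?_ h
    have h3 := Finset.single_le_sum (f := fun i => (nP i : ℝ) ^ ((2 * β + d) / (2 * γ i * β + d)))
      (fun i _ => by positivity) (Finset.mem_univ i)
    have h4 : (0 : ℝ) ≤ nQ := Nat.cast_nonneg _
    rw [effectiveSize]
    linarith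
  have h2 : t ^ (2 * β + d) =
      (t ^ (2 * γ i * β + d)) ^ ((2 * β + d) / (2 * γ i * β + d)) := by
    rw [← Real.rpow_mul ht]
    congr 1
    field_simp
  rw [h2] at h1
  exact (Real.rpow_le_rpow_iff (by positivity) (by positivity) (by positivity)).1 h1

open Filter Topology in
/-- On fine grids there is room for at least one cell, and the sources' deviations from `1/2` are
small. -/
theorem exists_grid_threshold {d m : ℕ} {α β A ca ℓ : ℝ} (γ Cγ : Fin m → ℝ) (hβ : 0 < β)
    (hαβ : α * β ≤ d) (hA : 0 < A) (hA1 : α * β = d → A = 1) (hγ : ∀ i, 0 < γ i) :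
    ∃ N₀ : ℕ, 0 < N₀ ∧ ∀ N ≥ N₀, 1 ≤ A * (N : ℝ) ^ (d - α * β) ∧
      ∀ i, Cγ i * (ca * (ℓ / N) ^ β) ^ γ i ≤ 1 / 4 := by
  have h1 : ∀ᶠ N : ℕ in atTop, 1 ≤ A * (N : ℝ) ^ (d - α * β) := by
    rcases hαβ.eq_or_lt with h | h
    · simp [h, hA1 h]
    · exact (((tendsto_rpow_atTop (sub_pos.2 h)).comp tendsto_natCast_atTop_atTop).const_mul_atTop
        hA).eventually_ge_atTop 1
  have h2 : ∀ᶠ N : ℕ in atTop, ∀ i, Cγ i * (ca * (ℓ / N) ^ β) ^ γ i ≤ 1 / 4 := by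
    refine eventually_all.2 fun i => ?_
    have h3 : Tendsto (fun N : ℕ => (ℓ / N : ℝ)) atTop (𝓝 0) :=
      tendsto_const_div_atTop_nhds_zero_nat ℓ
    have h4 : Tendsto (fun N : ℕ => (ℓ / N : ℝ) ^ β) atTop (𝓝 0) := by
      simpa [Real.zero_rpow hβ.ne'] using h3.rpow_const (Or.inr hβ.le)
    have h5 : Tendsto (fun N : ℕ => Cγ i * (ca * (ℓ / N : ℝ) ^ β) ^ γ i) atTop (𝓝 0) := by
      simpa [Real.zero_rpow (hγ i).ne'] using
        ((h4.const_mul ca).rpow_const (Or.inr (hγ i).le)).const_mul (Cγ i)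
    exact h5.eventually_le_const (by norm_num)
  obtain ⟨N₀, hN₀⟩ := eventually_atTop.1 (h1.and h2)
  exact ⟨N₀ + 1, Nat.succ_pos _, fun N hN => hN₀ N (by omega)⟩

/-- The lower bound at a grid size `N` fine enough for the sample sizes. The condition on `A` is
what the margin condition allows for the number `A * N ^ (d - α β)` of cells. -/
theorem le_minimaxRisk_of_grid {d m : ℕ} {α Cα β Cβ μm μp cμ rμ ℓ ε ca A : ℝ}
    {γ Cγ : Fin m → ℝ} (hα : 0 ≤ α) (hβ : 0 < β) (hCβ : 0 < Cβ) (hCα : 0 < Cα)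
    (hcμ : 0 < cμ) (hℓ : 0 < ℓ) (hℓ1 : ℓ ≤ 1) (hμm : 0 < μm) (hμmℓ : μm * ℓ ^ d < 1) (hε : 0 < ε)
    (hε1 : ε < 1 / 6) (hμpℓ : 1 < μp * ((1 - ε) * ℓ) ^ d)
    (hreg : cμ * max 1 (rμ / ℓ) ^ d ≤ ((1 - 6 * ε) / 2) ^ d)
    (hγ : ∀ i, 0 < γ i) (hCγ : ∀ i, 0 < Cγ i) (hca : 0 < ca) (hca1 : ca ≤ 1 / 4)
    (hcaβ : 2 * ca ≤ Cβ * ε ^ β) (hA : 0 < A) (hA1 : A ≤ 1)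
    (hAC : A ≤ Cα * ca ^ α * ℓ ^ (α * β)) {N : ℕ} (hN : 0 < N)
    (hN1 : 1 ≤ A * (N : ℝ) ^ (d - α * β))
    (hN2 : ∀ i, Cγ i * (ca * (ℓ / N) ^ β) ^ γ i ≤ 1 / 4) {nP : Fin m → ℕ} {nQ : ℕ}
    (hn : effectiveSize d β γ nP nQ ≤ (N : ℝ) ^ (2 * β + d)) :
    ENNReal.ofReal (A * ca * ℓ ^ β / (8 * Real.exp (32 * (∑ i, Cγ i ^ 2 + 1))) *
        (N : ℝ) ^ (-(β * (1 + α)))) ≤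
      minimaxRisk nP nQ (driftClass d m α Cα β Cβ γ Cγ μm μp cμ rμ) := by
  have hN' : (0 : ℝ) < N := by exact_mod_cast hN
  have hN1' : (1 : ℝ) ≤ N := by exact_mod_cast hN
  set h := ℓ / N with hhdef
  have hh : 0 < h := by positivity
  have hNh : N * h = ℓ := by rw [hhdef]; field_simp
  have hh1 : h ≤ 1 / N := by rw [hhdef]; gcongr
  have hhone : h ≤ 1 := hh1.trans (by rw [div_le_one hN']; exact hN1')
  set a := ca * h ^ β with hadef
  have ha : 0 < a := by positivity
  have ha' : a ≤ 1 / 4 := by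
    calc a ≤ 1 / 4 * 1 := by
          rw [hadef]; gcongr; exact Real.rpow_le_one hh.le hhone hβ.le
      _ = 1 / 4 := by norm_num
  have haN : a ≤ (N : ℝ) ^ (-β) := by
    calc a ≤ 1 * (1 / (N : ℝ)) ^ β := by rw [hadef]; gcongr; linarith
      _ = (N : ℝ) ^ (-β) := by rw [one_mul, one_div, Real.inv_rpow hN'.le, Real.rpow_neg hN'.le]
  set b : Fin m → ℝ := fun i => Cγ i * a ^ γ i with hbdef
  have hb : ∀ i, 0 ≤ b i := fun i => by have := hCγ i; positivity
  have hbN : ∀ i, b i ≤ Cγ i * (N : ℝ) ^ (-β * γ i) := fun i => by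
    have h1 := hCγ i
    have h2 := hγ i
    rw [Real.rpow_mul hN'.le]
    simp only [hbdef]
    gcongr
  have hhα : a ^ α = ca ^ α * ℓ ^ (α * β) * (N : ℝ) ^ (-(α * β)) := by
    rw [hadef, Real.mul_rpow hca.le (by positivity), ← Real.rpow_mul hh.le, hhdef,
      Real.div_rpow hℓ.le hN'.le, mul_comm β α, Real.rpow_neg hN'.le]
    ring
  have hw : ((1 : ℝ) / N) ^ d = (N : ℝ) ^ (-(d : ℝ)) := by
    rw [Real.rpow_neg hN'.le, Real.rpow_natCast, one_div, inv_pow]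
  -- as many cells as the margin condition allows
  set K := ⌊A * (N : ℝ) ^ (d - α * β)⌋₊ with hK
  have hKle : (K : ℝ) ≤ A * (N : ℝ) ^ (d - α * β) := Nat.floor_le (by positivity)
  have hKge : A * (N : ℝ) ^ (d - α * β) / 2 ≤ K := by
    have h1 := Nat.lt_floor_add_one (A * (N : ℝ) ^ (d - α * β))
    have h2 : (1 : ℝ) ≤ K := by exact_mod_cast (Nat.one_le_floor_iff _).2 hN1
    rw [← hK] at h1
    linarith
  have hKcard : K ≤ (Fintype.piFinset fun _ : Fin d => Finset.Ico (0 : ℤ) N).card := by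
    rw [Fintype.card_piFinset]
    simp only [Int.card_Ico, sub_zero, Int.toNat_natCast, Finset.prod_const, Finset.card_univ,
      Fintype.card_fin]
    have h1 : (K : ℝ) ≤ (N : ℝ) ^ d := by
      calc (K : ℝ) ≤ 1 * (N : ℝ) ^ ((d : ℝ) - 0) := by
            refine hKle.trans ?_
            gcongr
            positivity
        _ = (N : ℝ) ^ d := by rw [sub_zero, Real.rpow_natCast, one_mul]
    exact_mod_cast h1
  obtain ⟨T, hTsub, hTcard⟩ := Finset.exists_subset_card_eq hKcard
  have hT : ∀ k ∈ T, ∀ j, 0 ≤ k j ∧ k j < N := fun k hk j => by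
    simpa using Fintype.mem_piFinset.1 (hTsub hk) j
  have hprob := isProbabilityMeasure_combMeasure (d := d) hε (by linarith) hh hN
  have haβ : 2 * a ≤ Cβ * (ε * h) ^ β := by
    rw [Real.mul_rpow hε.le hh.le, hadef, ← mul_assoc, ← mul_assoc]
    gcongr
  have haα : T.card * (1 / (N : ℝ)) ^ d ≤ Cα * a ^ α := by
    rw [hTcard, hw, hhα]
    calc (K : ℝ) * (N : ℝ) ^ (-(d : ℝ)) ≤ A * (N : ℝ) ^ (d - α * β) * (N : ℝ) ^ (-(d : ℝ)) := by
          gcongr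
      _ = A * (N : ℝ) ^ (-(α * β)) := by
          rw [mul_assoc, ← Real.rpow_add hN']; ring_nf
      _ ≤ Cα * ca ^ α * ℓ ^ (α * β) * (N : ℝ) ^ (-(α * β)) := by gcongr
      _ = _ := by ring
  have hL : 32 * (1 / (N : ℝ)) ^ d * (∑ i, nP i * b i ^ 2 + nQ * a ^ 2) ≤
      32 * (∑ i, Cγ i ^ 2 + 1) := by
    have hQ : (1 / (N : ℝ)) ^ d * (nQ * a ^ 2) ≤ 1 := by
      calc (1 / (N : ℝ)) ^ d * (nQ * a ^ 2)
          ≤ (N : ℝ) ^ (-(d : ℝ)) * ((N : ℝ) ^ (2 * β + d) * ((N : ℝ) ^ (-β)) ^ 2) := by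
            rw [hw]
            gcongr
            exact (nQ_le_effectiveSize nP nQ).trans hn
        _ = 1 := by
            rw [← Real.rpow_natCast, ← Real.rpow_mul hN'.le, ← Real.rpow_add hN',
              ← Real.rpow_add hN']
            convert Real.rpow_zero (N : ℝ) using 2
            push_cast; ring
    have hP : ∀ i, (1 / (N : ℝ)) ^ d * (nP i * b i ^ 2) ≤ Cγ i ^ 2 := fun i => by
      have hbi := hb i
      calc (1 / (N : ℝ)) ^ d * (nP i * b i ^ 2)
          ≤ (N : ℝ) ^ (-(d : ℝ)) *
              ((N : ℝ) ^ (2 * γ i * β + d) * (Cγ i * (N : ℝ) ^ (-β * γ i)) ^ 2) := by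
            rw [hw]
            gcongr
            · exact nP_le_rpow_of_effectiveSize_le hβ hγ hN'.le hn i
            · exact hbN i
        _ = Cγ i ^ 2 * ((N : ℝ) ^ (-(d : ℝ)) * ((N : ℝ) ^ (2 * γ i * β + d) *
              ((N : ℝ) ^ (-β * γ i)) ^ 2)) := by ring
        _ = Cγ i ^ 2 := by
            rw [← Real.rpow_natCast ((N : ℝ) ^ (-β * γ i)), ← Real.rpow_mul hN'.le,
              ← Real.rpow_add hN', ← Real.rpow_add hN']
            have : -(d : ℝ) + (2 * γ i * β + d + -β * γ i * (2 : ℕ)) = 0 := by push_cast; ring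
            rw [this, Real.rpow_zero, mul_one]
    have hsum := Finset.sum_le_sum fun i (_ : i ∈ Finset.univ) => hP i
    rw [← Finset.mul_sum] at hsum
    rw [mul_assoc, mul_add ((1 / (N : ℝ)) ^ d)]
    linarith
  refine le_trans ?_ (le_minimaxRisk_of_hypercube (T := T) (a := a) (b := b)
    (w := (1 / (N : ℝ)) ^ d) (L := 32 * (∑ i, Cγ i ^ 2 + 1))
    isClosed_combPow.measurableSet (measurable_cellIndex (h := h)) ha ha' hb hN2
    (fun k hk => combMeasure_real_cell hε (by linarith) hh hN (hT k hk)) (by positivity) hL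
    fun A _ => signParam_mem_driftClass hα hβ hCβ hCα hcμ hℓ hℓ1 hμm hμmℓ hε hε1 hμpℓ hreg hN hh
      hNh hγ hT ha ha' haβ haα hb hN2 fun _ => rfl)
  apply ENNReal.ofReal_le_ofReal
  rw [hTcard, hw]
  have hexp := Real.exp_pos (32 * (∑ i, Cγ i ^ 2 + 1))
  set E := Real.exp (32 * (∑ i, Cγ i ^ 2 + 1))
  have hpow : (N : ℝ) ^ (d - α * β) * (N : ℝ) ^ (-β) * (N : ℝ) ^ (-(d : ℝ)) =
      (N : ℝ) ^ (-(β * (1 + α))) := by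
    rw [← Real.rpow_add hN', ← Real.rpow_add hN']; ring_nf
  have haeq : a = ca * ℓ ^ β * (N : ℝ) ^ (-β) := by
    rw [hadef, hhdef, Real.div_rpow hℓ.le hN'.le, Real.rpow_neg hN'.le]; ring
  calc A * ca * ℓ ^ β / (8 * E) * (N : ℝ) ^ (-(β * (1 + α)))
      = A * (N : ℝ) ^ (d - α * β) / 2 * a * (N : ℝ) ^ (-(d : ℝ)) / (4 * E) := by
        rw [← hpow, haeq]; field_simp; ring
    _ ≤ K * a * (N : ℝ) ^ (-(d : ℝ)) / (4 * E) := by gcongr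

end PosteriorDrift

open PosteriorDrift in
theorem theorem5 (d : ℕ) (hd : 0 < d) (α β Cβ μm μp cμ rμ ℓ : ℝ)
    (hα : 0 ≤ α) (hβ : 0 < β) (hβ1 : β ≤ 1) (hαβ : α * β ≤ d) (hCβ : 0 < Cβ)
    (hμm : 0 < μm) (hcμ : 0 < cμ) (hrμ : 0 < rμ)
    (hℓ : 0 < ℓ) (hℓ1 : ℓ ≤ 1) (hμmℓ : μm * ℓ ^ d < 1) (hμpℓ : 1 < μp * ℓ ^ d)
    (hreg : cμ * max 1 (rμ / ℓ) ^ d < (1 / 2) ^ d) :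
    ∃ C₀ : ℝ, ∀ Cα : ℝ, 0 < Cα → (α * β = d → C₀ ≤ Cα) →
      ∀ (m : ℕ) (γ Cγ : Fin m → ℝ), 0 < m → (∀ i, 0 < γ i) → (∀ i, 0 < Cγ i) →
        ∃ c : ℝ, 0 < c ∧ ∀ (nP : Fin m → ℕ) (nQ : ℕ), 0 < nQ + ∑ i, nP i →
          ENNReal.ofReal
              (c * PosteriorDrift.effectiveSize d β γ nP nQ ^
                (-(β * (1 + α) / (2 * β + d)))) ≤
            PosteriorDrift.minimaxRisk nP nQ
              (PosteriorDrift.driftClass d m α Cα β Cβ γ Cγ μm μp cμ rμ) := by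
  obtain ⟨ε, hε, hε1, hμpε, hregε⟩ := exists_gap_ratio d hμpℓ hreg
  set ca := min (Cβ * ε ^ β / 2) (1 / 4) with hcadef
  have hca : 0 < ca := lt_min (by positivity) (by norm_num)
  have hca1 : ca ≤ 1 / 4 := min_le_right _ _
  have hcaβ : 2 * ca ≤ Cβ * ε ^ β := by linarith [min_le_left (Cβ * ε ^ β / 2) (1 / 4)]
  refine ⟨1 / (ca ^ α * ℓ ^ (α * β)), fun Cα hCα hbdry m γ Cγ _ hγ hCγ => ?_⟩
  set A := min 1 (Cα * ca ^ α * ℓ ^ (α * β)) with hAdef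
  have hA : 0 < A := lt_min one_pos (by positivity)
  have hA1 : α * β = d → A = 1 := fun h => min_eq_left (by
    have := hbdry h
    rw [div_le_iff₀ (by positivity)] at this
    linarith)
  obtain ⟨N₀, hN₀, hgrid⟩ := exists_grid_threshold (ca := ca) (ℓ := ℓ) γ Cγ hβ hαβ hA hA1 hγ
  have hN₀' : (0 : ℝ) < N₀ := by exact_mod_cast hN₀
  have hN₀1 : (1 : ℝ) ≤ N₀ := by exact_mod_cast hN₀
  set B := A * ca * ℓ ^ β / (8 * Real.exp (32 * (∑ i, Cγ i ^ 2 + 1)))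
  have hB : 0 < B := by positivity
  refine ⟨B * (2 * N₀) ^ (-(β * (1 + α))), by positivity, fun nP nQ hn => ?_⟩
  set n := effectiveSize d β γ nP nQ
  have hn1 : 1 ≤ n := one_le_effectiveSize hβ hγ hn
  -- the grid size is a multiple of the bandwidth that balances signal and noise
  set t := n ^ (1 / (2 * β + d)) with ht
  have ht1 : 1 ≤ t := Real.one_le_rpow hn1 (by positivity)
  set N := N₀ * ⌈t⌉₊ with hN
  have htN : t ≤ N := by
    rw [hN]; push_cast
    have := Nat.le_ceil t
    nlinarith
  have hNt : (N : ℝ) ≤ 2 * N₀ * t := by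
    rw [hN]; push_cast
    have := Nat.ceil_lt_add_one (zero_le_one.trans ht1)
    nlinarith
  have hN1 : 1 ≤ ⌈t⌉₊ := Nat.one_le_ceil_iff.2 (by linarith)
  have hNN₀ : N₀ ≤ N := Nat.le_mul_of_pos_right _ hN1
  have hnN : n ≤ (N : ℝ) ^ (2 * β + d) := by
    calc n = t ^ (2 * β + d) := by
          rw [ht, ← Real.rpow_mul (by linarith), one_div, inv_mul_cancel₀ (by positivity),
            Real.rpow_one]
      _ ≤ _ := by gcongr
  obtain ⟨hg1, hg2⟩ := hgrid N hNN₀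
  refine le_trans (ENNReal.ofReal_le_ofReal ?_) (le_minimaxRisk_of_grid hα hβ hCβ hCα hcμ hℓ
    hℓ1 hμm hμmℓ hε hε1 hμpε hregε hγ hCγ hca hca1 hcaβ hA (min_le_left _ _) (min_le_right _ _)
    (hN₀.trans_le hNN₀) hg1 hg2 hnN)
  have hpow : n ^ (-(β * (1 + α) / (2 * β + d))) = t ^ (-(β * (1 + α))) := by
    rw [ht, ← Real.rpow_mul (by linarith)]
    congr 1
    ring
  rw [hpow, mul_assoc, ← Real.mul_rpow (by positivity) (by linarith)]
  refine mul_le_mul_of_nonneg_left ?_ hB.le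
  exact Real.rpow_le_rpow_of_nonpos (by linarith) hNt
    (neg_nonpos.2 (by positivity))
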